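/- For $m\ge 1$, a labeled linear chord diagram of $m$ chords is a set $C=\{(i_1,j_1),\dots,(i_m,j_m)\}$ of $m$ ordered pairs (chords) with $\{i_1,\dots,i_m,j_1,\dots,j_m\}=\{1,\dots,2m\}$. Let $\mathcal{LC}_m$ be the $\mathbb{Q}$-vector space spanned by these diagrams modulo the relations $C+C'=0$ whenever $C'$ is obtained from $C$ by reversing one of its ordered pairs. Let $\nu$ be the cyclic permutation $i\mapsto i-1$ modulo $2m$ of $\{1,\dots,2m\}$, acting on diagrams through their vertices and hence on $\mathcal{LC}_m$; let $\mathcal{C}_m\subset\mathcal{LC}_m$ be the subspace of $\nu$-invariants, and put $N=\sum_{s=0}^{2m-1}\nu^s\colon\mathcal{LC}_m\to\mathcal{C}_m$, which is surjective. For labeled linear chord diagrams $C$ of $m$ chords and $D$ of $l$ chords, the amalgamation $C*D$ is the following labeled linear chord diagram of $m+l-1$ chords. Let $p'$ and $q'$ be the other ends of the chords of $C$ and $D$ through the vertex $1$. Remove these two chords and renumber the remaining vertices, $v\mapsto v-1$ for those of $C$ and $w\mapsto w+2m-2$ for those of $D$. Finally add the chord $(q'+2m-2,\,p'-1)$ if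 the removed chords are $(1,p'),(1,q')$ or $(p',1),(q',1)$, and the chord $(p'-1,\,q'+2m-2)$ if they are $(1,p'),(q',1)$ or $(p',1),(1,q')$. Let $\mathcal{C}=\prod_{m\ge 2}\mathcal{C}_m$, with the bracket $[\mathcal{C}_m,\mathcal{C}_l]\subset\mathcal{C}_{m+l-1}$ given by bilinearity and $$[N(C),N(D)]=\sum_{s=0}^{2m-1}\sum_{t=0}^{2l-1}N\bigl((\nu^sC)*(\nu^tD)\bigr),$$ and extended to the product degree by degree (only finitely many pairs of degrees contribute to a given degree). Let $\Omega_m=N(\{(1,2),(3,4),\dots,(2m-1,2m)\})\in\mathcal{C}_m$. Theorem. $\mathcal{C}$ is a Lie algebra over $\mathbb{Q}$ with this bracket, and its center is $$Z(\mathcal{C})=\prod_{m\ge 2}\mathbb{Q}\,\Omega_m .$$ Moreover, if $m\ge 2$ and $X\in\mathcal{C}_m$ satisfies $[X,\mathcal{C}_{3m+2}]=0$, then $X\in Z(\mathcal{C})$. -/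

import Mathlib

/-- A labeled diagram of chords on a set `V` of vertices: a decomposition of `V` into unordered
pairs `{v, partner v}`, each pair (chord) being oriented.  `isTail v` says that `v` is the first
entry of the ordered pair containing it, so the set of ordered pairs is
`{(v, partner v) | isTail v = true}`. -/
@[ext]
structure LabeledDiagram (V : Type) where
  partner : V → V
  isTail : V → Bool
  partner_partner : ∀ v, partner (partner v) = v
  partner_ne : ∀ v, partner v ≠ v
  isTail_partner : ∀ v, isTail (partner v) = !(isTail v)

namespace LabeledDiagram

/-- Relabeling of the vertices: `{(i, j), …}` becomes `{(e i, e j), …}`. -/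
def map {V W : Type} (e : V ≃ W) (C : LabeledDiagram V) : LabeledDiagram W where
  partner w := e (C.partner (e.symm w))
  isTail w := C.isTail (e.symm w)
  partner_partner w := by simp [C.partner_partner]
  partner_ne w := by
    intro h
    exact C.partner_ne (e.symm w) ((Equiv.eq_symm_apply e).2 h)
  isTail_partner w := by simp [C.isTail_partner]

/-- The single label change: reverse the orientation of the chord through `v`. -/
def flip {V : Type} [DecidableEq V] (C : LabeledDiagram V) (v : V) : LabeledDiagram V where
  partner := C.partner
  isTail w := if w = v ∨ C.partner w = v then !(C.isTail w) else C.isTail w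
  partner_partner := C.partner_partner
  partner_ne := C.partner_ne
  isTail_partner w := by
    rw [C.partner_partner, C.isTail_partner]
    by_cases h : w = v ∨ C.partner w = v
    · rw [if_pos h, if_pos h.symm]
    · rw [if_neg h, if_neg (fun h' => h h'.symm)]

/-- Fuse the chord of `C` through `p` with the chord of `D` through `q`: remove the vertices
`p`, `q` and their chords, and join the other ends `p' = C.partner p` and `q' = D.partner q`
by a new chord.  The new chord is
`(q', p')` if the removed chords are `(p, p')` and `(q, q')`,
`(p', q')` if they are `(p, p')` and `(q', q)`,
`(p', q')` if they are `(p', p)` and `(q, q')`,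
`(q', p')` if they are `(p', p)` and `(q', q)`;
that is, `p'` is its tail exactly when one and only one of `p`, `q` is a tail. -/
def fuse {V W : Type} [DecidableEq V] [DecidableEq W]
    (C : LabeledDiagram V) (p : V) (D : LabeledDiagram W) (q : W) :
    LabeledDiagram ({v : V // v ≠ p} ⊕ {w : W // w ≠ q}) where
  partner
    | Sum.inl v =>
        if h : C.partner v.1 = p then Sum.inr ⟨D.partner q, D.partner_ne q⟩
        else Sum.inl ⟨C.partner v.1, h⟩
    | Sum.inr w =>
        if h : D.partner w.1 = q then Sum.inl ⟨C.partner p, C.partner_ne p⟩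
        else Sum.inr ⟨D.partner w.1, h⟩
  isTail
    | Sum.inl v =>
        if C.partner v.1 = p then xor (C.isTail p) (D.isTail q) else C.isTail v.1
    | Sum.inr w =>
        if D.partner w.1 = q then !(xor (C.isTail p) (D.isTail q)) else D.isTail w.1
  partner_partner := by
    rintro (⟨v, hv⟩ | ⟨w, hw⟩)
    · by_cases h : C.partner v = p
      · have h2 : C.partner p = v := by rw [← h, C.partner_partner]
        simp [h, D.partner_partner, h2]
      · simp [h, C.partner_partner, hv]
    · by_cases h : D.partner w = q
      · have h2 : D.partner q = w := by rw [← h, D.partner_partner]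
        simp [h, C.partner_partner, h2]
      · simp [h, D.partner_partner, hw]
  partner_ne := by
    rintro (⟨v, hv⟩ | ⟨w, hw⟩)
    · by_cases h : C.partner v = p
      · simp [h]
      · simp [h, C.partner_ne]
    · by_cases h : D.partner w = q
      · simp [h]
      · simp [h, D.partner_ne]
  isTail_partner := by
    rintro (⟨v, hv⟩ | ⟨w, hw⟩)
    · by_cases h : C.partner v = p
      · simp [h, D.partner_partner]
      · simp [h, C.partner_partner, hv, C.isTail_partner]
    · by_cases h : D.partner w = q
      · simp [h, C.partner_partner]
      · simp [h, D.partner_partner, hw, D.isTail_partner]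

end LabeledDiagram

/-- A labeled linear chord diagram of `m` chords.  The vertices `1, …, 2m` are numbered
`0, …, 2m - 1` here. -/
abbrev LinearDiagram (m : ℕ) : Type := LabeledDiagram (Fin (2 * m))

/-- The numbering of the vertices of an amalgamation (`k = m + l - 1` chords): a vertex `v ≠ 0` of
the first diagram gets the number `v - 1`, a vertex `w ≠ 0` of the second the number
`w + 2m - 2`. -/
def amalgamEquiv {m l k : ℕ} (hm : 0 < m) (hl : 0 < l) (h : m + l = k + 1) :
    ({v : Fin (2 * m) // v ≠ ⟨0, by omega⟩} ⊕ {w : Fin (2 * l) // w ≠ ⟨0, by omega⟩}) ≃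
      Fin (2 * k) where
  toFun
    | Sum.inl v => ⟨v.1.1 - 1, by have := v.1.2; omega⟩
    | Sum.inr w => ⟨w.1.1 + (2 * m - 2), by
        have := w.1.2; omega⟩
  invFun i :=
    if hi : i.1 < 2 * m - 1 then Sum.inl ⟨⟨i.1 + 1, by omega⟩, by simp⟩
    else Sum.inr ⟨⟨i.1 - (2 * m - 2), by have := i.2; omega⟩, by
      simp only [ne_eq, Fin.mk.injEq]; omega⟩
  left_inv := by
    rintro (⟨⟨v, hv⟩, hv0⟩ | ⟨⟨w, hw⟩, hw0⟩)
    · simp only [ne_eq, Fin.mk.injEq] at hv0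
      have h1 : v - 1 < 2 * m - 1 := by omega
      have h2 : v - 1 + 1 = v := by omega
      simp [h1, h2]
    · simp only [ne_eq, Fin.mk.injEq] at hw0
      have h1 : ¬ (w + (2 * m - 2) < 2 * m - 1) := by omega
      simp [h1]
  right_inv := by
    rintro ⟨i, hi⟩
    by_cases h1 : i < 2 * m - 1
    · simp [h1]
    · have h2 : i - (2 * m - 2) + (2 * m - 2) = i := by omega
      simp [h1, h2]

/-- The amalgamation `C * D` of two labeled linear chord diagrams, at their first vertices. -/
def amalgam {m l k : ℕ} (hm : 0 < m) (hl : 0 < l) (h : m + l = k + 1)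
    (C : LinearDiagram m) (D : LinearDiagram l) : LinearDiagram k :=
  (C.fuse ⟨0, by omega⟩ D ⟨0, by omega⟩).map (amalgamEquiv hm hl h)

/-- The cyclic permutation `ν`, `i ↦ i - 1` modulo `2m`, of the vertices. -/
def cyc (m : ℕ) : Equiv.Perm (Fin (2 * m)) := (finRotate (2 * m)).symm

noncomputable section

/-- The span of the elements `C + C'`, where `C'` is obtained from `C` by a single label change. -/
def labelRel (m : ℕ) : Submodule ℚ (LinearDiagram m →₀ ℚ) :=
  Submodule.span ℚ {x | ∃ (C : LinearDiagram m) (v : Fin (2 * m)),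
    x = Finsupp.single C 1 + Finsupp.single (C.flip v) 1}

/-- The space `𝓛𝓒_m` of oriented linear chord diagrams of `m` chords. -/
abbrev OrientedLinear (m : ℕ) : Type := (LinearDiagram m →₀ ℚ) ⧸ labelRel m

/-- The class of a labeled linear chord diagram. -/
def OrientedLinear.mk {m : ℕ} (C : LinearDiagram m) : OrientedLinear m :=
  (labelRel m).mkQ (Finsupp.single C 1)

theorem OrientedLinear.mk_flip {m : ℕ} (C : LinearDiagram m) (v : Fin (2 * m)) :
    OrientedLinear.mk (C.flip v) = -OrientedLinear.mk C := by
  rw [eq_neg_iff_add_eq_zero, add_comm]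
  unfold OrientedLinear.mk
  rw [← map_add]
  exact (Submodule.Quotient.mk_eq_zero _).2 (Submodule.subset_span ⟨C, v, rfl⟩)

/-- The linear extension to `𝓛𝓒_m` of a map on labeled linear chord diagrams that changes its
sign under single label changes. -/
def OrientedLinear.lift {m : ℕ} {M : Type} [AddCommGroup M] [Module ℚ M] (f : LinearDiagram m → M)
    (hf : ∀ C v, f (LabeledDiagram.flip C v) = -f C) : OrientedLinear m →ₗ[ℚ] M :=
  (labelRel m).liftQ (Finsupp.linearCombination ℚ f) (by
    rw [labelRel, Submodule.span_le]
    rintro x ⟨C, v, rfl⟩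
    simp [hf])

@[simp]
theorem OrientedLinear.lift_mk {m : ℕ} {M : Type} [AddCommGroup M] [Module ℚ M]
    (f : LinearDiagram m → M) (hf : ∀ C v, f (LabeledDiagram.flip C v) = -f C)
    (C : LinearDiagram m) : OrientedLinear.lift f hf (OrientedLinear.mk C) = f C := by
  simp [OrientedLinear.lift, OrientedLinear.mk]

theorem OrientedLinear.hom_ext {m : ℕ} {M : Type} [AddCommGroup M] [Module ℚ M]
    {f g : OrientedLinear m →ₗ[ℚ] M}
    (h : ∀ C, f (OrientedLinear.mk C) = g (OrientedLinear.mk C)) : f = g := by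
  apply Submodule.linearMap_qext
  ext C
  exact h C

theorem LabeledDiagram.map_flip {V W : Type} [DecidableEq V] [DecidableEq W] (e : V ≃ W)
    (C : LabeledDiagram V) (v : V) : (C.flip v).map e = (C.map e).flip (e v) := by
  ext w
  · rfl
  · simp [LabeledDiagram.map, LabeledDiagram.flip, Equiv.symm_apply_eq]

theorem LabeledDiagram.isTail_flip {V : Type} [DecidableEq V] (C : LabeledDiagram V) (v w : V) :
    (C.flip v).isTail w = xor (decide (w = v ∨ C.partner w = v)) (C.isTail w) := by
  by_cases h : w = v ∨ C.partner w = v <;> simp [flip, h]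

theorem LabeledDiagram.fuse_flip_left {V W : Type} [DecidableEq V] [DecidableEq W]
    (C : LabeledDiagram V) (p : V) (D : LabeledDiagram W) (q : W) (v : V) :
    ∃ u, (C.flip v).fuse p D q = (C.fuse p D q).flip u := by
  have hinv := C.partner_partner
  by_cases hv : v = p ∨ C.partner v = p
  · have hp : p = v ∨ C.partner p = v := by
      rcases hv with h | h
      · exact Or.inl h.symm
      · exact Or.inr (by rw [← h, hinv])
    refine ⟨Sum.inl ⟨C.partner p, C.partner_ne p⟩, ?_⟩
    ext x
    · rfl
    · rw [isTail_flip]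
      rcases x with ⟨a, ha⟩ | ⟨b, hb⟩
      · by_cases h : C.partner a = p
        · have h' : a = C.partner p := by rw [← h, hinv]
          have h2 : C.partner (C.partner p) = p := hinv p
          simp only [fuse, flip, h', h2, hp]
          cases C.isTail p <;> cases D.isTail q <;> simp
        · have h1 : ¬ (a = v ∨ C.partner a = v) := by
            rintro h1; rcases hv with hv | hv <;> rcases h1 with h1 | h1 <;> grind
          have h2 : a ≠ C.partner p := by grind
          have h3 : C.partner a ≠ C.partner p := by grind
          simp [fuse, flip, h, h1, h2, h3]
      · by_cases h : D.partner b = q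
        · simp [fuse, flip, h, hp]
        · simp [fuse, flip, h]
  · have hp : ¬ (p = v ∨ C.partner p = v) := by grind
    refine ⟨Sum.inl ⟨v, fun h => hv (Or.inl h)⟩, ?_⟩
    ext x
    · rfl
    · rw [isTail_flip]
      rcases x with ⟨a, ha⟩ | ⟨b, hb⟩
      · by_cases h : C.partner a = p
        · have h1 : a ≠ v := by grind
          simp [fuse, flip, h, hp, h1]
        · by_cases h1 : a = v ∨ C.partner a = v <;> simp [fuse, flip, h, h1]
      · by_cases h : D.partner b = q
        · have h1 : C.partner p ≠ v := by grind
          have h2 : p ≠ v := by grind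
          simp [fuse, flip, h, h1, h2]
        · simp [fuse, flip, h]

theorem LabeledDiagram.fuse_flip_right {V W : Type} [DecidableEq V] [DecidableEq W]
    (C : LabeledDiagram V) (p : V) (D : LabeledDiagram W) (q : W) (w : W) :
    ∃ u, C.fuse p (D.flip w) q = (C.fuse p D q).flip u := by
  have hinv := D.partner_partner
  by_cases hw : w = q ∨ D.partner w = q
  · have hq : q = w ∨ D.partner q = w := by
      rcases hw with h | h
      · exact Or.inl h.symm
      · exact Or.inr (by rw [← h, hinv])
    refine ⟨Sum.inr ⟨D.partner q, D.partner_ne q⟩, ?_⟩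
    ext x
    · rfl
    · rw [isTail_flip]
      rcases x with ⟨a, ha⟩ | ⟨b, hb⟩
      · by_cases h : C.partner a = p
        · simp [fuse, flip, h, hq]
        · simp [fuse, flip, h]
      · by_cases h : D.partner b = q
        · have h' : b = D.partner q := by rw [← h, hinv]
          have h2 : D.partner (D.partner q) = q := hinv q
          simp only [fuse, flip, h', h2, hq]
          cases C.isTail p <;> cases D.isTail q <;> simp
        · have h1 : ¬ (b = w ∨ D.partner b = w) := by
            rintro h1; rcases hw with hw | hw <;> rcases h1 with h1 | h1 <;> grind
          have h2 : b ≠ D.partner q := by grind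
          have h3 : D.partner b ≠ D.partner q := by grind
          simp [fuse, flip, h, h1, h2, h3]
  · have hq : ¬ (q = w ∨ D.partner q = w) := by grind
    refine ⟨Sum.inr ⟨w, fun h => hw (Or.inl h)⟩, ?_⟩
    ext x
    · rfl
    · rw [isTail_flip]
      rcases x with ⟨a, ha⟩ | ⟨b, hb⟩
      · by_cases h : C.partner a = p
        · have h1 : D.partner q ≠ w := by grind
          have h2 : q ≠ w := by grind
          simp [fuse, flip, h, h1, h2]
        · simp [fuse, flip, h]
      · by_cases h : D.partner b = q
        · have h1 : b ≠ w := by grind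
          simp [fuse, flip, h, hq, h1]
        · by_cases h1 : b = w ∨ D.partner b = w <;> simp [fuse, flip, h, h1]

/-- The action of `ν` on `𝓛𝓒_m`. -/
def rotate (m : ℕ) : OrientedLinear m →ₗ[ℚ] OrientedLinear m :=
  OrientedLinear.lift (fun C => OrientedLinear.mk (C.map (cyc m))) (fun C v => by
    rw [LabeledDiagram.map_flip, OrientedLinear.mk_flip])

/-- The space `𝓒_m` of oriented chord diagrams of `m` chords: the invariants in `𝓛𝓒_m` of the
cyclic group generated by `ν`. -/
def OrientedChord (m : ℕ) : Submodule ℚ (OrientedLinear m) :=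
  LinearMap.eqLocus (rotate m) LinearMap.id

theorem finRotate_pow_self (n : ℕ) : (finRotate n) ^ n = 1 := by
  rcases n with _ | n
  · rfl
  · have h : ∀ (s : ℕ) (i : Fin (n + 1)), (((finRotate (n + 1)) ^ s) i).1 = (i.1 + s) % (n + 1) := by
      intro s
      induction s with
      | zero => intro i; simp [Nat.mod_eq_of_lt i.2]
      | succ s ih =>
        intro i
        rw [pow_succ', Equiv.Perm.mul_apply, finRotate_apply, Fin.val_add, ih, Fin.val_one',
          ← Nat.add_mod, add_assoc]
    ext i
    rw [h]
    simp [Nat.mod_eq_of_lt i.2]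

theorem rotate_pow_mk (m s : ℕ) (C : LinearDiagram m) :
    ((rotate m) ^ s) (OrientedLinear.mk C) = OrientedLinear.mk (C.map ((cyc m) ^ s)) := by
  induction s with
  | zero => rfl
  | succ s ih =>
    rw [pow_succ', Module.End.mul_apply, ih, rotate, OrientedLinear.lift_mk, pow_succ']
    rfl

theorem rotate_pow (m : ℕ) : (rotate m) ^ (2 * m) = 1 := by
  apply OrientedLinear.hom_ext
  intro C
  have h : (cyc m) ^ (2 * m) = 1 := by
    have h1 : cyc m = (finRotate (2 * m))⁻¹ := rfl
    rw [h1, inv_pow, finRotate_pow_self, inv_one]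
  rw [rotate_pow_mk, h]
  rfl

theorem sum_rotate_pow_mem (m : ℕ) (x : OrientedLinear m) :
    (∑ s ∈ Finset.range (2 * m), (rotate m) ^ s) x ∈ OrientedChord m := by
  have h : rotate m * (∑ s ∈ Finset.range (2 * m), (rotate m) ^ s) =
      ∑ s ∈ Finset.range (2 * m), (rotate m) ^ s := by
    have h1 := Finset.sum_range_succ (fun s => (rotate m) ^ s) (2 * m)
    rw [Finset.sum_range_succ', rotate_pow, pow_zero, add_right_cancel_iff] at h1
    rw [Finset.mul_sum, ← h1]
    exact Finset.sum_congr rfl fun s _ => (pow_succ' _ _).symm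
  exact LinearMap.congr_fun h x

/-- The map `N = ∑ ν ^ s`, `0 ≤ s ≤ 2m - 1`, from `𝓛𝓒_m` to `𝓒_m`. -/
def cyclicSum (m : ℕ) : OrientedLinear m →ₗ[ℚ] OrientedChord m :=
  LinearMap.codRestrict (OrientedChord m) (∑ s ∈ Finset.range (2 * m), (rotate m) ^ s)
    (sum_rotate_pow_mem m)

theorem cyclicSum_coe {m : ℕ} (x : OrientedLinear m) :
    (cyclicSum m x).1 = ∑ s ∈ Finset.range (2 * m), ((rotate m) ^ s) x := by
  unfold cyclicSum
  rw [LinearMap.codRestrict_apply, LinearMap.sum_apply]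

theorem cyclicSum_surjective {m : ℕ} (hm : 0 < m) : Function.Surjective (cyclicSum m) := by
  intro x
  have h : ∀ s : ℕ, ((rotate m) ^ s) x.1 = x.1 := by
    intro s
    induction s with
    | zero => rfl
    | succ s ih => rw [pow_succ, Module.End.mul_apply, show rotate m x.1 = x.1 from x.2, ih]
  refine ⟨((2 * m : ℕ) : ℚ)⁻¹ • x.1, ?_⟩
  ext1
  have h2 : ((2 * m : ℕ) : ℚ) ≠ 0 := by positivity
  rw [cyclicSum_coe]
  simp only [map_smul, h]
  rw [Finset.sum_const, Finset.card_range, ← Nat.cast_smul_eq_nsmul ℚ, smul_smul,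
    mul_inv_cancel₀ h2, one_smul]

/-- The bilinear extension of the amalgamation to `𝓛𝓒_m × 𝓛𝓒_l → 𝓛𝓒_{m + l - 1}`. -/
def amalgamLinear {m l k : ℕ} (hm : 0 < m) (hl : 0 < l) (h : m + l = k + 1) :
    OrientedLinear m →ₗ[ℚ] OrientedLinear l →ₗ[ℚ] OrientedLinear k :=
  OrientedLinear.lift
    (fun C => OrientedLinear.lift (fun D => OrientedLinear.mk (amalgam hm hl h C D))
      (fun D w => by
        obtain ⟨u, hu⟩ := C.fuse_flip_right ⟨0, by omega⟩ D ⟨0, by omega⟩ w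
        rw [amalgam, hu, LabeledDiagram.map_flip, OrientedLinear.mk_flip, amalgam]))
    (fun C v => by
      apply OrientedLinear.hom_ext
      intro D
      obtain ⟨u, hu⟩ := C.fuse_flip_left ⟨0, by omega⟩ D ⟨0, by omega⟩ v
      simp only [OrientedLinear.lift_mk, LinearMap.neg_apply]
      rw [amalgam, hu, LabeledDiagram.map_flip, OrientedLinear.mk_flip, amalgam])

/-- The bracket `𝓒_m × 𝓒_l → 𝓒_{m + l - 1}`, `[x, y] = N (x * y)`.  By `cyclicSum_surjective` and
`homBracket_cyclicSum`, it is the bilinear map with `[N(C), N(D)] = ∑ N((ν ^ s C) * (ν ^ t D))`, the sum running over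
`0 ≤ s < 2m` and `0 ≤ t < 2l`, that is, over the pairs of vertices of the two diagrams. -/
def homBracket {m l k : ℕ} (hm : 0 < m) (hl : 0 < l) (h : m + l = k + 1) :
    OrientedChord m →ₗ[ℚ] OrientedChord l →ₗ[ℚ] OrientedChord k :=
  ((amalgamLinear hm hl h).compl₁₂ (OrientedChord m).subtype (OrientedChord l).subtype).compr₂
    (cyclicSum k)

theorem homBracket_cyclicSum {m l k : ℕ} (hm : 0 < m) (hl : 0 < l) (h : m + l = k + 1)
    (C : LinearDiagram m) (D : LinearDiagram l) :
    homBracket hm hl h (cyclicSum m (OrientedLinear.mk C)) (cyclicSum l (OrientedLinear.mk D)) =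
      ∑ s ∈ Finset.range (2 * m), ∑ t ∈ Finset.range (2 * l),
        cyclicSum k (OrientedLinear.mk
          (amalgam hm hl h (C.map ((cyc m) ^ s)) (D.map ((cyc l) ^ t)))) := by
  have h1 : homBracket hm hl h (cyclicSum m (OrientedLinear.mk C))
      (cyclicSum l (OrientedLinear.mk D)) =
      cyclicSum k (amalgamLinear hm hl h (cyclicSum m (OrientedLinear.mk C)).1
        (cyclicSum l (OrientedLinear.mk D)).1) := rfl
  rw [h1, cyclicSum_coe, cyclicSum_coe]
  simp only [map_sum, rotate_pow_mk, LinearMap.sum_apply, amalgamLinear, OrientedLinear.lift_mk]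
  exact Finset.sum_comm

/-- The space `𝓒 = ∏_{m ≥ 2} 𝓒_m`. -/
abbrev ChordAlgebra : Type := (i : {m : ℕ // 2 ≤ m}) → OrientedChord i.1

/-- The bracket of `𝓒`: the component in degree `k` of `[X, Y]` is the sum of the brackets
`[X_m, Y_l]` over all `m, l ≥ 2` with `m + l - 1 = k`. -/
def chordBracket : ChordAlgebra →ₗ[ℚ] ChordAlgebra →ₗ[ℚ] ChordAlgebra :=
  LinearMap.mk₂ ℚ
    (fun X Y k => ∑ p ∈ (Finset.HasAntidiagonal.antidiagonal (k.1 + 1)).attach,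
      if h : 2 ≤ p.1.1 ∧ 2 ≤ p.1.2 then
        homBracket (by omega) (by omega) (Finset.HasAntidiagonal.mem_antidiagonal.1 p.2) (X ⟨p.1.1, h.1⟩)
          (Y ⟨p.1.2, h.2⟩)
      else 0)
    (fun X X' Y => by
      funext k
      rw [Pi.add_apply, ← Finset.sum_add_distrib]
      refine Finset.sum_congr rfl fun p _ => ?_
      split_ifs <;> simp)
    (fun c X Y => by
      funext k
      rw [Pi.smul_apply, Finset.smul_sum]
      refine Finset.sum_congr rfl fun p _ => ?_
      split_ifs <;> simp)
    (fun X Y Y' => by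
      funext k
      rw [Pi.add_apply, ← Finset.sum_add_distrib]
      refine Finset.sum_congr rfl fun p _ => ?_
      split_ifs <;> simp)
    (fun c X Y => by
      funext k
      rw [Pi.smul_apply, Finset.smul_sum]
      refine Finset.sum_congr rfl fun p _ => ?_
      split_ifs <;> simp)

/-- The center of `𝓒`. -/
def chordCenter : Submodule ℚ ChordAlgebra where
  carrier := {X | ∀ Y, chordBracket X Y = 0}
  zero_mem' Y := by simp
  add_mem' {X X'} hX hX' Y := by rw [map_add, LinearMap.add_apply, hX, hX', add_zero]
  smul_mem' c X hX Y := by rw [map_smul, LinearMap.smul_apply, hX, smul_zero]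

/-- The diagram `I_m = {(1, 2), (3, 4), …, (2m - 1, 2m)}`. -/
def isolatedLinear (m : ℕ) : LinearDiagram m where
  partner v := if h : v.1 % 2 = 0 then ⟨v.1 + 1, by have := v.2; omega⟩
    else ⟨v.1 - 1, by have := v.2; omega⟩
  isTail v := decide (v.1 % 2 = 0)
  partner_partner v := by
    ext
    by_cases h : v.1 % 2 = 0
    · have h1 : ¬ ((v.1 + 1) % 2 = 0) := by omega
      simp [h, h1]
    · have h1 : (v.1 - 1) % 2 = 0 := by omega
      simp only [h, h1, dif_neg, dif_pos, not_false_eq_true]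
      omega
  partner_ne v := by
    intro h
    by_cases h1 : v.1 % 2 = 0
    · rw [dif_pos h1] at h
      have h2 : v.1 + 1 = v.1 := congrArg Fin.val h
      omega
    · rw [dif_neg h1] at h
      have h2 : v.1 - 1 = v.1 := congrArg Fin.val h
      omega
  isTail_partner v := by
    by_cases h : v.1 % 2 = 0
    · have h1 : ¬ ((v.1 + 1) % 2 = 0) := by omega
      simp [h, h1]
    · have h1 : (v.1 - 1) % 2 = 0 := by omega
      simp [h, h1]

/-- The chord diagram `Ω_m`, the closing of `I_m`, as the element `N(I_m)` of `𝓒_m`. -/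
def Omega (m : ℕ) : OrientedChord m := cyclicSum m (OrientedLinear.mk (isolatedLinear m))

end

/-! Up to rotation, `C * D` is the fusion of two cyclic diagrams at chosen vertices, so each
assertion about the bracket reduces to comparing fusions and counting reversed chords.

Antisymmetry: `C * D` lists the vertices of `C` and then those of `D`. A rotation by `2m - 1` gives
the list of `D * C`, and only the new chord has the other orientation (`amalgamLinear_swap`).

Jacobi: in `[x, [y, z]]` the diagram `x` is fused to a vertex coming either from `y` or from `z`.
This gives `M(x, y, z) - M(x, z, y)`, where in `M` (`midBracket`) the middle argument meets both
others. Doing the two fusions in the other order changes an even number of signs: two chords are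
reversed if two chords of the middle diagram are used, none if its two used vertices are joined
(`amalgamLinear_amalgamLinear`). Hence `M(x, y, z) = M(z, y, x)`, and the Jacobi identity is the
cancellation of such terms. It passes to the product because each degree of a bracket involves
finitely many degrees of its arguments.

`Ω_m` is central: fusing `D` with an isolated chord cuts `D` open and inserts it in place of that
chord. Each place to cut occurs twice, once for either end of the chord, with opposite signs
(`amalgamLinear_rotate_isolated`).

Nothing else is central: let `L` be a diagram of `3m + 2` long chords without rotational symmetry.
If vertex `0` of `C` is not paired with a cyclic neighbour, then in `C * L` the short chords at the
two ends of the block left by `C` mark its position. So `C`, the rotation of `L` and the overall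
rotation can all be read off from `C * L` (`eq_of_amalgam_longDiagram_eq`). The coefficient of `C *
L` in `[X, N(L)]` is therefore that of `C` in `X`. If the bracket vanishes, then by invariance of
`X` only diagrams pairing every vertex with a neighbour occur in `X`. These are `I_m` and its
rotation by one step, so `X` is a multiple of `Ω_m` (`mem_span_Omega_of_homBracket_eq_zero`). -/

namespace LabeledDiagram

/-! ### Fusions with arbitrary placement of the vertices, and their exchange. -/

/-- `E` is the fusion of `C` at `p` and `D` at `q`, the vertices of `C` other than `p` and those
of `D` other than `q` being placed by `f` and `g`. -/
structure IsFusion {V W X : Type} (C : LabeledDiagram V) (p : V) (D : LabeledDiagram W) (q : W)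
    (E : LabeledDiagram X) (f : V → X) (g : W → X) : Prop where
  partner_left : ∀ v, v ≠ p → C.partner v ≠ p → E.partner (f v) = f (C.partner v)
  partner_right : ∀ w, w ≠ q → D.partner w ≠ q → E.partner (g w) = g (D.partner w)
  partner_fused : E.partner (f (C.partner p)) = g (D.partner q)
  isTail_left : ∀ v, v ≠ p → C.partner v ≠ p → E.isTail (f v) = C.isTail v
  isTail_right : ∀ w, w ≠ q → D.partner w ≠ q → E.isTail (g w) = D.isTail w
  isTail_fused : E.isTail (f (C.partner p)) = xor (C.isTail p) (D.isTail q)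
  inj_left : ∀ v v', v ≠ p → v' ≠ p → f v = f v' → v = v'
  inj_right : ∀ w w', w ≠ q → w' ≠ q → g w = g w' → w = w'
  disjoint : ∀ v w, v ≠ p → w ≠ q → f v ≠ g w
  cover : ∀ x, (∃ v, v ≠ p ∧ f v = x) ∨ ∃ w, w ≠ q ∧ g w = x

namespace IsFusion

variable {V W X Y : Type} {C : LabeledDiagram V} {p : V} {D : LabeledDiagram W} {q : W}
  {E : LabeledDiagram X} {f : V → X} {g : W → X}

theorem partner_fused' (h : IsFusion C p D q E f g) :
    E.partner (g (D.partner q)) = f (C.partner p) := by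
  rw [← h.partner_fused, E.partner_partner]

theorem isTail_fused' (h : IsFusion C p D q E f g) :
    E.isTail (g (D.partner q)) = !(xor (C.isTail p) (D.isTail q)) := by
  rw [← h.partner_fused, E.isTail_partner, h.isTail_fused]

theorem map (h : IsFusion C p D q E f g) (e : X ≃ Y) :
    IsFusion C p D q (E.map e) (e ∘ f) (e ∘ g) where
  partner_left v h1 h2 := by simp [LabeledDiagram.map, h.partner_left v h1 h2]
  partner_right v h1 h2 := by simp [LabeledDiagram.map, h.partner_right v h1 h2]
  partner_fused := by simp [LabeledDiagram.map, h.partner_fused]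
  isTail_left v h1 h2 := by simp [LabeledDiagram.map, h.isTail_left v h1 h2]
  isTail_right v h1 h2 := by simp [LabeledDiagram.map, h.isTail_right v h1 h2]
  isTail_fused := by simp [LabeledDiagram.map, h.isTail_fused]
  inj_left v v' h1 h2 h3 := h.inj_left v v' h1 h2 (e.injective h3)
  inj_right v v' h1 h2 h3 := h.inj_right v v' h1 h2 (e.injective h3)
  disjoint v w h1 h2 h3 := h.disjoint v w h1 h2 (e.injective h3)
  cover x := by
    rcases h.cover (e.symm x) with ⟨v, h1, h2⟩ | ⟨v, h1, h2⟩
    · exact Or.inl ⟨v, h1, by simp [h2]⟩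
    · exact Or.inr ⟨v, h1, by simp [h2]⟩

theorem of_map_left {e : V ≃ Y} {p : Y} {f : Y → X}
    (h : IsFusion (C.map e) p D q E f g) : IsFusion C (e.symm p) D q E (f ∘ e) g where
  partner_left v h1 h2 := by
    have := h.partner_left (e v) (by grind) (by simp [LabeledDiagram.map]; grind)
    simpa [LabeledDiagram.map] using this
  partner_right := h.partner_right
  partner_fused := by
    have := h.partner_fused
    simpa [LabeledDiagram.map] using this
  isTail_left v h1 h2 := by
    have := h.isTail_left (e v) (by grind) (by simp [LabeledDiagram.map]; grind)
    simpa [LabeledDiagram.map] using this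
  isTail_right := h.isTail_right
  isTail_fused := by
    have := h.isTail_fused
    simpa [LabeledDiagram.map] using this
  inj_left v v' h1 h2 h3 := e.injective (h.inj_left _ _ (by grind) (by grind) h3)
  inj_right := h.inj_right
  disjoint v w h1 h2 := h.disjoint _ _ (by grind) h2
  cover x := by
    rcases h.cover x with ⟨v, h1, h2⟩ | h1
    · exact Or.inl ⟨e.symm v, fun h => h1 (e.symm.injective h), by simp [h2]⟩
    · exact Or.inr h1

theorem of_map_right {e : W ≃ Y} {q : Y} {g : Y → X}
    (h : IsFusion C p (D.map e) q E f g) : IsFusion C p D (e.symm q) E f (g ∘ e) where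
  partner_left := h.partner_left
  partner_right v h1 h2 := by
    have := h.partner_right (e v) (by grind) (by simp [LabeledDiagram.map]; grind)
    simpa [LabeledDiagram.map] using this
  partner_fused := by
    have := h.partner_fused
    simpa [LabeledDiagram.map] using this
  isTail_left := h.isTail_left
  isTail_right v h1 h2 := by
    have := h.isTail_right (e v) (by grind) (by simp [LabeledDiagram.map]; grind)
    simpa [LabeledDiagram.map] using this
  isTail_fused := by
    have := h.isTail_fused
    simpa [LabeledDiagram.map] using this
  inj_left := h.inj_left
  inj_right v v' h1 h2 h3 := e.injective (h.inj_right _ _ (by grind) (by grind) h3)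
  disjoint v w h1 h2 := h.disjoint _ _ h1 (by grind)
  cover x := by
    rcases h.cover x with h1 | ⟨v, h1, h2⟩
    · exact Or.inl h1
    · exact Or.inr ⟨e.symm v, fun h => h1 (e.symm.injective h), by simp [h2]⟩

/-- Exchanging the two diagrams reverses the fused chord. -/
theorem eq_flip_of_swap [DecidableEq X] (h : IsFusion C p D q E f g) {E' : LabeledDiagram X}
    {f' : V → X} {g' : W → X} (h' : IsFusion D q C p E' g' f')
    (hf : ∀ v, v ≠ p → f v = f' v) (hg : ∀ w, w ≠ q → g w = g' w) :
    E' = E.flip (f (C.partner p)) := by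
  have hCp := C.partner_ne p
  have hDq := D.partner_ne q
  have hCpp := C.partner_partner
  have hDpp := D.partner_partner
  have e1 : f' (C.partner p) = f (C.partner p) := (hf _ hCp).symm
  have e2 : g' (D.partner q) = g (D.partner q) := (hg _ hDq).symm
  ext x
  · rcases h.cover x with ⟨v, hv, rfl⟩ | ⟨w, hw, rfl⟩
    · by_cases hvp : C.partner v = p
      · obtain rfl : v = C.partner p := by grind
        have := h'.partner_fused'
        rw [e1, e2] at this
        simp only [flip, this, h.partner_fused]
      · have := h'.partner_right v hv hvp
        rw [← hf v hv, ← hf _ hvp] at this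
        simp only [flip, this, h.partner_left v hv hvp]
    · by_cases hwq : D.partner w = q
      · obtain rfl : w = D.partner q := by grind
        have := h'.partner_fused
        rw [e1, e2] at this
        simp only [flip, this, h.partner_fused']
      · have := h'.partner_left w hw hwq
        rw [← hg w hw, ← hg _ hwq] at this
        simp only [flip, this, h.partner_right w hw hwq]
  · rw [isTail_flip]
    rcases h.cover x with ⟨v, hv, rfl⟩ | ⟨w, hw, rfl⟩
    · by_cases hvp : C.partner v = p
      · obtain rfl : v = C.partner p := by grind
        have := h'.isTail_fused'
        rw [e1] at this
        simp [this, h.isTail_fused, Bool.xor_comm]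
      · have := h'.isTail_right v hv hvp
        rw [← hf v hv] at this
        rw [this, h.isTail_left v hv hvp, h.partner_left v hv hvp]
        have a1 : f v ≠ f (C.partner p) := fun hh => by
          have := h.inj_left _ _ hv hCp hh
          grind
        have a2 : f (C.partner v) ≠ f (C.partner p) := fun hh => by
          have := h.inj_left _ _ hvp hCp hh
          grind
        simp [a1, a2]
    · by_cases hwq : D.partner w = q
      · obtain rfl : w = D.partner q := by grind
        have := h'.isTail_fused
        rw [e2] at this
        simp [this, h.isTail_fused', h.partner_fused', Bool.xor_comm]
      · have := h'.isTail_left w hw hwq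
        rw [← hg w hw] at this
        rw [this, h.isTail_right w hw hwq, h.partner_right w hw hwq]
        have a1 := (h.disjoint _ _ hCp hw).symm
        have a2 := (h.disjoint _ _ hCp hwq).symm
        simp [a1, a2]

end IsFusion

/-! ### Two successive fusions into a common diagram. -/

/-- `E` is obtained from `A`, `B`, `C` by fusing `A` at `p` with `B` at `a` and `C` at `q` with
`B` at `b`; the remaining vertices are placed by `f`, `g`, `h`. -/
structure IsDoubleFusion {V W U X : Type} (A : LabeledDiagram V) (p : V) (B : LabeledDiagram W)
    (a b : W) (C : LabeledDiagram U) (q : U) (E : LabeledDiagram X)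
    (f : V → X) (g : W → X) (h : U → X) : Prop where
  partner_left : ∀ v, v ≠ p → A.partner v ≠ p →
    E.partner (f v) = f (A.partner v) ∧ E.isTail (f v) = A.isTail v
  partner_mid : ∀ w, w ≠ a → w ≠ b → B.partner w ≠ a → B.partner w ≠ b →
    E.partner (g w) = g (B.partner w) ∧ E.isTail (g w) = B.isTail w
  partner_right : ∀ u, u ≠ q → C.partner u ≠ q →
    E.partner (h u) = h (C.partner u) ∧ E.isTail (h u) = C.isTail u
  fused_left : B.partner a ≠ b → E.partner (f (A.partner p)) = g (B.partner a) ∧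
    E.isTail (f (A.partner p)) = xor (A.isTail p) (B.isTail a)
  fused_right : B.partner a ≠ b → E.partner (h (C.partner q)) = g (B.partner b) ∧
    E.isTail (h (C.partner q)) = !(xor (B.isTail b) (C.isTail q))
  fused_both : B.partner a = b → E.partner (f (A.partner p)) = h (C.partner q) ∧
    E.isTail (f (A.partner p)) = xor (A.isTail p) (xor (B.isTail b) (C.isTail q))
  inj_left : ∀ v v', v ≠ p → v' ≠ p → f v = f v' → v = v'
  inj_mid : ∀ w w', w ≠ a → w ≠ b → w' ≠ a → w' ≠ b → g w = g w' → w = w'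
  inj_right : ∀ u u', u ≠ q → u' ≠ q → h u = h u' → u = u'
  disjoint_left_mid : ∀ v w, v ≠ p → w ≠ a → w ≠ b → f v ≠ g w
  disjoint_left_right : ∀ v u, v ≠ p → u ≠ q → f v ≠ h u
  disjoint_mid_right : ∀ w u, w ≠ a → w ≠ b → u ≠ q → g w ≠ h u
  cover : ∀ x, (∃ v, v ≠ p ∧ f v = x) ∨ (∃ w, w ≠ a ∧ w ≠ b ∧ g w = x) ∨ ∃ u, u ≠ q ∧ h u = x

/-- The outer fusion takes place at the vertex of the inner one that comes from `a`. Whether its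
partner lies in `B` or in `C` depends on whether `a` is joined to `b`, hence the case distinction in
`IsDoubleFusion`. -/
theorem IsFusion.isDoubleFusion {V W U X Y : Type} {A : LabeledDiagram V} {p : V}
    {B : LabeledDiagram W} {a b : W} {C : LabeledDiagram U} {q : U} {D : LabeledDiagram Y}
    {E : LabeledDiagram X} {f : V → X} {k : Y → X} {g : W → Y} {h : U → Y} {r : Y}
    (hD : IsFusion B b C q D g h) (hE : IsFusion A p D r E f k) (hr : g a = r) (hab : a ≠ b) :
    IsDoubleFusion A p B a b C q E f (k ∘ g) (k ∘ h) := by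
  subst hr
  have hB := B.partner_partner
  have hC := C.partner_partner
  have hBn := B.partner_ne
  have hCn := C.partner_ne
  have gne : ∀ w, w ≠ a → w ≠ b → g w ≠ g a := fun w h1 h2 h3 =>
    h1 (hD.inj_left w a h2 hab h3)
  have hne : ∀ u, u ≠ q → h u ≠ g a := fun u h1 h2 => hD.disjoint a u hab h1 h2.symm
  refine
    { partner_left := fun v h1 h2 => ⟨hE.partner_left v h1 h2, hE.isTail_left v h1 h2⟩
      partner_mid := fun w h1 h2 h3 h4 => ?_
      partner_right := fun u h1 h2 => ?_
      fused_left := fun h1 => ?_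
      fused_right := fun h1 => ?_
      fused_both := fun h1 => ?_
      inj_left := hE.inj_left
      inj_mid := fun w w' h1 h2 h3 h4 h5 =>
        hD.inj_left w w' h2 h4 (hE.inj_right _ _ (gne w h1 h2) (gne w' h3 h4) h5)
      inj_right := fun u u' h1 h2 h3 =>
        hD.inj_right u u' h1 h2 (hE.inj_right _ _ (hne u h1) (hne u' h2) h3)
      disjoint_left_mid := fun v w h1 h2 h3 => hE.disjoint v _ h1 (gne w h2 h3)
      disjoint_left_right := fun v u h1 h2 => hE.disjoint v _ h1 (hne u h2)
      disjoint_mid_right := fun w u h1 h2 h3 h4 =>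
        hD.disjoint w u h2 h3 (hE.inj_right _ _ (gne w h1 h2) (hne u h3) h4)
      cover := fun x => ?_ }
  · have e := hD.partner_left w h2 h4
    have e' : D.partner (g w) ≠ g a := by rw [e]; exact gne _ h3 h4
    exact ⟨by simp [hE.partner_right _ (gne w h1 h2) e', e],
      by simp [hE.isTail_right _ (gne w h1 h2) e', hD.isTail_left w h2 h4]⟩
  · have e := hD.partner_right u h1 h2
    have e' : D.partner (h u) ≠ g a := by rw [e]; exact hne _ h2
    exact ⟨by simp [hE.partner_right _ (hne u h1) e', e],
      by simp [hE.isTail_right _ (hne u h1) e', hD.isTail_right u h1 h2]⟩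
  · have e := hD.partner_left a hab h1
    exact ⟨by simp [hE.partner_fused, e], by simp [hE.isTail_fused, hD.isTail_left a hab h1]⟩
  · have e := hD.partner_fused'
    have e' : D.partner (h (C.partner q)) ≠ g a := by
      rw [e]; exact gne _ (by grind) (hBn b)
    have h2 := hne _ (hCn q)
    exact ⟨by simp [hE.partner_right _ h2 e', e],
      by simp [hE.isTail_right _ h2 e', hD.isTail_fused']⟩
  · have e : B.partner b = a := by grind
    have e1 := hD.partner_fused
    have e2 := hD.isTail_fused
    rw [e] at e1 e2
    exact ⟨by simp [hE.partner_fused, e1], by rw [hE.isTail_fused, e2]⟩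
  · rcases hE.cover x with h1 | ⟨y, hy, rfl⟩
    · exact Or.inl h1
    · rcases hD.cover y with ⟨w, h1, rfl⟩ | ⟨u, h1, rfl⟩
      · exact Or.inr (Or.inl ⟨w, fun h => hy (by rw [h]), h1, rfl⟩)
      · exact Or.inr (Or.inr ⟨u, h1, rfl⟩)

namespace IsDoubleFusion

variable {V W U X : Type} {A : LabeledDiagram V} {p : V} {B : LabeledDiagram W} {a b : W}
  {C : LabeledDiagram U} {q : U} {E E' : LabeledDiagram X} {f f' : V → X} {g g' : W → X}
  {h h' : U → X}

/-- The values of the placing maps at the fused vertices `p`, `a`, `b`, `q` are meaningless.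
Different numbering formulas have to agree only elsewhere. -/
theorem congr_maps (H : IsDoubleFusion A p B a b C q E f g h)
    (hf : ∀ v, v ≠ p → f v = f' v) (hg : ∀ w, w ≠ a → w ≠ b → g w = g' w)
    (hh : ∀ u, u ≠ q → h u = h' u) : IsDoubleFusion A p B a b C q E f' g' h' := by
  have hAn := A.partner_ne
  have hBn := B.partner_ne
  have hCn := C.partner_ne
  have hB := B.partner_partner
  constructor
  · intro v h1 h2
    rw [← hf v h1, ← hf _ h2]; exact H.partner_left v h1 h2
  · intro v h1 h2 h3 h4
    rw [← hg v h1 h2, ← hg _ h3 h4]; exact H.partner_mid v h1 h2 h3 h4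
  · intro v h1 h2
    rw [← hh v h1, ← hh _ h2]; exact H.partner_right v h1 h2
  · intro h1
    rw [← hf _ (hAn p), ← hg _ (hBn a) h1]; exact H.fused_left h1
  · intro h1
    rw [← hh _ (hCn q), ← hg _ (by grind) (hBn b)]; exact H.fused_right h1
  · intro h1
    rw [← hf _ (hAn p), ← hh _ (hCn q)]; exact H.fused_both h1
  · intro v v' h1 h2
    rw [← hf _ h1, ← hf _ h2]; exact H.inj_left v v' h1 h2
  · intro v v' h1 h2 h3 h4
    rw [← hg _ h1 h2, ← hg _ h3 h4]; exact H.inj_mid v v' h1 h2 h3 h4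
  · intro v v' h1 h2
    rw [← hh _ h1, ← hh _ h2]; exact H.inj_right v v' h1 h2
  · intro v w h1 h2 h3
    rw [← hf _ h1, ← hg _ h2 h3]; exact H.disjoint_left_mid v w h1 h2 h3
  · intro v w h1 h2
    rw [← hf _ h1, ← hh _ h2]; exact H.disjoint_left_right v w h1 h2
  · intro v w h1 h2 h3
    rw [← hg _ h1 h2, ← hh _ h3]; exact H.disjoint_mid_right v w h1 h2 h3
  · intro x
    rcases H.cover x with ⟨v, h1, rfl⟩ | ⟨v, h1, h2, rfl⟩ | ⟨v, h1, rfl⟩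
    · exact Or.inl ⟨v, h1, (hf v h1).symm⟩
    · exact Or.inr (Or.inl ⟨v, h1, h2, (hg v h1 h2).symm⟩)
    · exact Or.inr (Or.inr ⟨v, h1, (hh v h1).symm⟩)

/-- If the two ends of a single chord of `B` are used, the order of the fusions is irrelevant. -/
theorem eq_of_swap_of_eq (H : IsDoubleFusion A p B a b C q E f g h)
    (H' : IsDoubleFusion C q B b a A p E' h g f) (e : B.partner a = b) : E' = E := by
  have hApp := A.partner_partner
  have hBpp := B.partner_partner
  have hCpp := C.partner_partner
  have e' : B.partner b = a := by grind
  obtain ⟨k1, k2⟩ := H.fused_both e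
  obtain ⟨k1', k2'⟩ := H'.fused_both e'
  have k3 := E.isTail_partner (f (A.partner p))
  have k3' := E'.isTail_partner (h (C.partner q))
  have k4 := E.partner_partner (f (A.partner p))
  have k4' := E'.partner_partner (h (C.partner q))
  rw [k1] at k3 k4
  rw [k1'] at k3' k4'
  have k5 := B.isTail_partner a
  rw [e] at k5
  ext x
  · rcases H.cover x with ⟨v, h1, rfl⟩ | ⟨v, h1, h2, rfl⟩ | ⟨v, h1, rfl⟩
    · by_cases hv : A.partner v = p
      · obtain rfl : v = A.partner p := by grind
        rw [k1, k4']
      · rw [(H.partner_left v h1 hv).1, (H'.partner_right v h1 hv).1]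
    · rw [(H.partner_mid v h1 h2 (by grind) (by grind)).1,
        (H'.partner_mid v h2 h1 (by grind) (by grind)).1]
    · by_cases hv : C.partner v = q
      · obtain rfl : v = C.partner q := by grind
        rw [k4, k1']
      · rw [(H.partner_right v h1 hv).1, (H'.partner_left v h1 hv).1]
  · rcases H.cover x with ⟨v, h1, rfl⟩ | ⟨v, h1, h2, rfl⟩ | ⟨v, h1, rfl⟩
    · by_cases hv : A.partner v = p
      · obtain rfl : v = A.partner p := by grind
        rw [k2, k3', k2', k5]
        cases A.isTail p <;> cases B.isTail a <;> cases C.isTail q <;> rfl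
      · rw [(H.partner_left v h1 hv).2, (H'.partner_right v h1 hv).2]
    · rw [(H.partner_mid v h1 h2 (by grind) (by grind)).2,
        (H'.partner_mid v h2 h1 (by grind) (by grind)).2]
    · by_cases hv : C.partner v = q
      · obtain rfl : v = C.partner q := by grind
        rw [k3, k2, k2', k5]
        cases A.isTail p <;> cases B.isTail a <;> cases C.isTail q <;> rfl
      · rw [(H.partner_right v h1 hv).2, (H'.partner_left v h1 hv).2]

/-- If two chords of `B` are used, exchanging the order of the fusions reverses both
fused chords. -/
theorem eq_flip_flip_of_swap [DecidableEq X] (H : IsDoubleFusion A p B a b C q E f g h)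
    (H' : IsDoubleFusion C q B b a A p E' h g f) (e : B.partner a ≠ b) :
    E' = (E.flip (f (A.partner p))).flip (h (C.partner q)) := by
  have hApp := A.partner_partner
  have hBpp := B.partner_partner
  have hCpp := C.partner_partner
  have hAn := A.partner_ne
  have hBn := B.partner_ne
  have hCn := C.partner_ne
  have e' : B.partner b ≠ a := by grind
  obtain ⟨k1, k2⟩ := H.fused_left e
  obtain ⟨l1, l2⟩ := H.fused_right e
  obtain ⟨k1', k2'⟩ := H'.fused_right e'
  obtain ⟨l1', l2'⟩ := H'.fused_left e'
  have d1 := H.disjoint_left_right _ _ (hAn p) (hCn q)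
  have d2 := H.disjoint_left_mid _ _ (hAn p) (hBn a) e
  have d3 := H.disjoint_left_mid _ _ (hAn p) e' (hBn b)
  have d4 := H.disjoint_mid_right _ _ (hBn a) e (hCn q)
  have d5 := H.disjoint_mid_right _ _ e' (hBn b) (hCn q)
  have inv : ∀ F : LabeledDiagram X, ∀ s t, F.partner s = t →
      F.partner t = s ∧ F.isTail t = !(F.isTail s) := by
    rintro F s t rfl
    exact ⟨F.partner_partner s, F.isTail_partner s⟩
  obtain ⟨k3, k4⟩ := inv _ _ _ k1
  obtain ⟨l3, l4⟩ := inv _ _ _ l1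
  obtain ⟨k3', k4'⟩ := inv _ _ _ k1'
  obtain ⟨l3', l4'⟩ := inv _ _ _ l1'
  ext x
  · change E'.partner x = E.partner x
    rcases H.cover x with ⟨v, h1, rfl⟩ | ⟨v, h1, h2, rfl⟩ | ⟨v, h1, rfl⟩
    · by_cases hv : A.partner v = p
      · obtain rfl : v = A.partner p := by grind
        rw [k1, k1']
      · rw [(H.partner_left v h1 hv).1, (H'.partner_right v h1 hv).1]
    · by_cases hva : B.partner v = a
      · obtain rfl : v = B.partner a := by grind
        rw [k3, k3']
      · by_cases hvb : B.partner v = b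
        · obtain rfl : v = B.partner b := by grind
          rw [l3, l3']
        · rw [(H.partner_mid v h1 h2 hva hvb).1, (H'.partner_mid v h2 h1 hvb hva).1]
    · by_cases hv : C.partner v = q
      · obtain rfl : v = C.partner q := by grind
        rw [l1, l1']
      · rw [(H.partner_right v h1 hv).1, (H'.partner_left v h1 hv).1]
  · rw [isTail_flip, isTail_flip]
    change _ = xor (decide (x = h (C.partner q) ∨ E.partner x = h (C.partner q))) _
    rcases H.cover x with ⟨v, h1, rfl⟩ | ⟨v, h1, h2, rfl⟩ | ⟨v, h1, rfl⟩
    · by_cases hv : A.partner v = p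
      · obtain rfl : v = A.partner p := by grind
        simp [k1, k2, k2', d1, d4, Bool.xor_comm]
      · rw [(H.partner_left v h1 hv).1, (H.partner_left v h1 hv).2,
          (H'.partner_right v h1 hv).2]
        have a1 : f v ≠ f (A.partner p) := fun hh => by
          have := H.inj_left _ _ h1 (hAn p) hh
          grind
        have a2 : f (A.partner v) ≠ f (A.partner p) := fun hh => by
          have := H.inj_left _ _ hv (hAn p) hh
          grind
        have a3 := H.disjoint_left_right _ _ h1 (hCn q)
        have a4 := H.disjoint_left_right _ _ hv (hCn q)
        simp [a1, a2, a3, a4]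
    · by_cases hva : B.partner v = a
      · obtain rfl : v = B.partner a := by grind
        simp [k3, k4, k4', k2, k2', d1, d4, Bool.xor_comm]
      · by_cases hvb : B.partner v = b
        · obtain rfl : v = B.partner b := by grind
          simp [l3, l4, l4', l2, l2', d1.symm, d3.symm, Bool.xor_comm]
        · rw [(H.partner_mid v h1 h2 hva hvb).1, (H.partner_mid v h1 h2 hva hvb).2,
            (H'.partner_mid v h2 h1 hvb hva).2]
          have a1 := (H.disjoint_left_mid _ _ (hAn p) h1 h2).symm
          have a2 := (H.disjoint_left_mid _ _ (hAn p) hva hvb).symm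
          have a3 := H.disjoint_mid_right _ _ h1 h2 (hCn q)
          have a4 := H.disjoint_mid_right _ _ hva hvb (hCn q)
          simp [a1, a2, a3, a4]
    · by_cases hv : C.partner v = q
      · obtain rfl : v = C.partner q := by grind
        simp [l1, l2, l2', d1.symm, d3.symm, Bool.xor_comm]
      · rw [(H.partner_right v h1 hv).1, (H.partner_right v h1 hv).2,
          (H'.partner_left v h1 hv).2]
        have a1 : h v ≠ h (C.partner q) := fun hh => by
          have := H.inj_right _ _ h1 (hCn q) hh
          grind
        have a2 : h (C.partner v) ≠ h (C.partner q) := fun hh => by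
          have := H.inj_right _ _ hv (hCn q) hh
          grind
        have a3 := (H.disjoint_left_right _ _ (hAn p) h1).symm
        have a4 := (H.disjoint_left_right _ _ (hAn p) hv).symm
        simp [a1, a2, a3, a4]

end IsDoubleFusion

theorem isFusion_fuse {V W X : Type} [DecidableEq V] [DecidableEq W] (C : LabeledDiagram V) (p : V)
    (D : LabeledDiagram W) (q : W) (e : {v : V // v ≠ p} ⊕ {w : W // w ≠ q} ≃ X)
    {f : V → X} {g : W → X} (hf : ∀ v h, e (Sum.inl ⟨v, h⟩) = f v)
    (hg : ∀ w h, e (Sum.inr ⟨w, h⟩) = g w) :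
    IsFusion C p D q ((C.fuse p D q).map e) f g where
  partner_left v h1 h2 := by
    rw [← hf v h1, ← hf _ h2]; simp [map, fuse, h2]
  partner_right v h1 h2 := by
    rw [← hg v h1, ← hg _ h2]; simp [map, fuse, h2]
  partner_fused := by
    rw [← hf _ (C.partner_ne p), ← hg _ (D.partner_ne q)]; simp [map, fuse, C.partner_partner]
  isTail_left v h1 h2 := by
    rw [← hf v h1]; simp [map, fuse, h2]
  isTail_right v h1 h2 := by
    rw [← hg v h1]; simp [map, fuse, h2]
  isTail_fused := by
    rw [← hf _ (C.partner_ne p)]; simp [map, fuse, C.partner_partner]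
  inj_left v v' h1 h2 h := by
    rw [← hf v h1, ← hf v' h2] at h; simpa using h
  inj_right v v' h1 h2 h := by
    rw [← hg v h1, ← hg v' h2] at h; simpa using h
  disjoint v w h1 h2 := by
    rw [← hf v h1, ← hg w h2]; simp
  cover x := by
    rcases h : e.symm x with ⟨v, hv⟩ | ⟨w, hw⟩
    · exact Or.inl ⟨v, hv, by rw [← hf v hv, ← h, e.apply_symm_apply]⟩
    · exact Or.inr ⟨w, hw, by rw [← hg w hw, ← h, e.apply_symm_apply]⟩

end LabeledDiagram

/-! ### Amalgamation of linear diagrams: numbering, exchange and reassociation up to rotation. -/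

open LabeledDiagram

/-- The numbering, in an amalgamation, of the vertices of the first diagram. -/
def numberLeft {m k : ℕ} (h : m ≤ k) (v : Fin (2 * m)) : Fin (2 * k) :=
  ⟨v.1 - 1, by have := v.2; omega⟩

/-- The numbering, in an amalgamation, of the vertices of the second diagram. -/
def numberRight {m l k : ℕ} (hm : 0 < m) (h : m + l = k + 1) (w : Fin (2 * l)) : Fin (2 * k) :=
  ⟨w.1 + (2 * m - 2), by have := w.2; omega⟩

theorem isFusion_amalgam {m l k : ℕ} (hm : 0 < m) (hl : 0 < l) (h : m + l = k + 1)
    (C : LinearDiagram m) (D : LinearDiagram l) :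
    IsFusion C ⟨0, by omega⟩ D ⟨0, by omega⟩ (amalgam hm hl h C D)
      (numberLeft (by omega)) (numberRight hm h) :=
  isFusion_fuse _ _ _ _ _ (fun _ _ => rfl) (fun _ _ => rfl)

theorem cyc_symm_pow_val {m s : ℕ} (hs : s ≤ 2 * m) (i : Fin (2 * m)) :
    (((cyc m) ^ s).symm i).1 = if i.1 + s < 2 * m then i.1 + s else i.1 + s - 2 * m := by
  obtain ⟨n, hn⟩ : ∃ n, 2 * m = n + 1 := ⟨2 * m - 1, by have := i.2; omega⟩
  have key : ∀ (N : ℕ) (h : N = n + 1) (s : ℕ) (i : Fin N),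
      (((finRotate N) ^ s) i).1 = (i.1 + s) % N := by
    rintro N rfl s
    induction s with
    | zero => intro i; simp [Nat.mod_eq_of_lt i.2]
    | succ s ih =>
      intro i
      rw [pow_succ', Equiv.Perm.mul_apply, finRotate_apply, Fin.val_add, ih, Fin.val_one',
        ← Nat.add_mod, add_assoc]
  have h1 : ((cyc m) ^ s).symm = (finRotate (2 * m)) ^ s := by
    change ((finRotate (2 * m))⁻¹ ^ s)⁻¹ = _
    rw [inv_pow, inv_inv]
  rw [h1, key _ hn]
  have := i.2
  split_ifs with h2
  · exact Nat.mod_eq_of_lt h2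
  · rw [Nat.mod_eq_sub_mod (by omega), Nat.mod_eq_of_lt (by omega)]

theorem cyc_pow_val {m s : ℕ} (hs : s ≤ 2 * m) (i : Fin (2 * m)) :
    (((cyc m) ^ s) i).1 = if s ≤ i.1 then i.1 - s else i.1 + 2 * m - s := by
  have h := cyc_symm_pow_val hs (((cyc m) ^ s) i)
  rw [Equiv.symm_apply_apply] at h
  have := i.2
  have := (((cyc m) ^ s) i).2
  split_ifs at h ⊢ <;> omega

namespace OrientedLinear

theorem mk_map_cyc_pow {m : ℕ} (s : ℕ) (C : LinearDiagram m) :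
    mk (C.map ((cyc m) ^ s)) = ((rotate m) ^ s) (mk C) := (rotate_pow_mk m s C).symm

theorem amalgamLinear_mk {m l k : ℕ} (hm : 0 < m) (hl : 0 < l) (h : m + l = k + 1)
    (C : LinearDiagram m) (D : LinearDiagram l) :
    amalgamLinear hm hl h (mk C) (mk D) = mk (amalgam hm hl h C D) := by
  simp [amalgamLinear]

/-- The block of the first diagram has `2m - 1` vertices. Rotating past it puts the second block in
front, and the sign comes from the fused chord. -/
theorem amalgamLinear_swap {m l k : ℕ} (hm : 0 < m) (hl : 0 < l) (h : m + l = k + 1)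
    (h' : l + m = k + 1) (x : OrientedLinear m) (y : OrientedLinear l) :
    ((rotate k) ^ (2 * m - 1)) (amalgamLinear hm hl h x y) = -amalgamLinear hl hm h' y x := by
  have key : (amalgamLinear hm hl h).compr₂ ((rotate k) ^ (2 * m - 1)) =
      -(amalgamLinear hl hm h').flip := by
    refine hom_ext fun C => hom_ext fun D => ?_
    have h1 := (isFusion_amalgam hm hl h C D).map ((cyc k) ^ (2 * m - 1))
    have h2 := isFusion_amalgam hl hm h' D C
    have h3 := h1.eq_flip_of_swap h2
      (by
        rintro v hv
        have := v.2
        have : v.1 ≠ 0 := fun h => hv (Fin.ext h)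
        ext
        simp only [Function.comp, cyc_pow_val (show 2 * m - 1 ≤ 2 * k by omega), numberLeft,
          numberRight]
        split_ifs <;> omega)
      (by
        rintro v hv
        have := v.2
        have : v.1 ≠ 0 := fun h => hv (Fin.ext h)
        ext
        simp only [Function.comp, cyc_pow_val (show 2 * m - 1 ≤ 2 * k by omega), numberLeft,
          numberRight]
        split_ifs <;> omega)
    simp only [LinearMap.compr₂_apply, LinearMap.neg_apply, LinearMap.flip_apply,
      amalgamLinear_mk]
    rw [h3, mk_flip, neg_neg, mk_map_cyc_pow]
  exact LinearMap.congr_fun₂ key x y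

/-- Both sides fuse `y` at its vertex `s + 1` with `x` and at its vertex `0` with `z`; the condition
on `s` says that the two vertices are distinct vertices of `y`. The outer rotation skips the
vertices of `x` and the `2 * m₂ - s - 2` vertices of `y` behind `s + 1`, so that `z` comes first. -/
theorem amalgamLinear_amalgamLinear {m₁ m₂ m₃ k k' r s : ℕ} (h₁ : 0 < m₁) (h₂ : 0 < m₂)
    (h₃ : 0 < m₃) (hk : m₂ + m₃ = k + 1) (hk' : m₂ + m₁ = k' + 1) (hr : m₁ + k = r + 1)
    (hr' : m₃ + k' = r + 1) (hs : s + 1 < 2 * m₂) (x : OrientedLinear m₁) (y : OrientedLinear m₂)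
    (z : OrientedLinear m₃) :
    ((rotate r) ^ (2 * m₁ - 1 + (2 * m₂ - s - 2)))
      (amalgamLinear h₁ (by omega) hr x (((rotate k) ^ s) (amalgamLinear h₂ h₃ hk y z))) =
    amalgamLinear h₃ (by omega) hr' z (((rotate k') ^ (2 * m₂ - s - 2))
      (amalgamLinear h₂ h₁ hk' (((rotate m₂) ^ (s + 1)) y) x)) := by
  set R := 2 * m₁ - 1 + (2 * m₂ - s - 2)
  set S := 2 * m₂ - s - 2
  -- Both sides are packaged as trilinear maps, so that it suffices to compare them on diagrams.
  let T₁ : OrientedLinear m₁ →ₗ[ℚ] OrientedLinear m₂ →ₗ[ℚ] OrientedLinear m₃ →ₗ[ℚ]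
      OrientedLinear r :=
    LinearMap.mk₂ ℚ (fun x y => ((rotate r) ^ R).comp
        ((amalgamLinear h₁ (by omega) hr x).comp
          (((rotate k) ^ s).comp (amalgamLinear h₂ h₃ hk y))))
      (by intros; ext; simp) (by intros; ext; simp) (by intros; ext; simp) (by intros; ext; simp)
  let T₂ : OrientedLinear m₁ →ₗ[ℚ] OrientedLinear m₂ →ₗ[ℚ] OrientedLinear m₃ →ₗ[ℚ]
      OrientedLinear r :=
    LinearMap.mk₂ ℚ (fun x y => (amalgamLinear h₃ (by omega) hr').flip
        (((rotate k') ^ S) (amalgamLinear h₂ h₁ hk' (((rotate m₂) ^ (s + 1)) y) x)))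
      (by intros; ext; simp) (by intros; ext; simp) (by intros; ext; simp) (by intros; ext; simp)
  have key : T₁ = T₂ := by
    refine hom_ext fun A => hom_ext fun B => hom_ext fun C => ?_
    change ((rotate r) ^ R) (amalgamLinear h₁ _ hr (mk A) (((rotate k) ^ s)
        (amalgamLinear h₂ h₃ hk (mk B) (mk C)))) =
      amalgamLinear h₃ _ hr' (mk C) (((rotate k') ^ S)
      (amalgamLinear h₂ h₁ hk' (((rotate m₂) ^ (s + 1)) (mk B)) (mk A)))
    simp only [amalgamLinear_mk, ← mk_map_cyc_pow]
    set a : Fin (2 * m₂) := ⟨s + 1, hs⟩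
    set b : Fin (2 * m₂) := ⟨0, by omega⟩
    have hab : a ≠ b := by simp [a, b]
    have f₁ := ((isFusion_amalgam h₂ h₃ hk B C).map ((cyc k) ^ s)).isDoubleFusion (a := a)
      ((isFusion_amalgam h₁ (by omega) hr A _).map ((cyc r) ^ R))
      (by
        ext
        simp only [Function.comp, cyc_pow_val (show s ≤ 2 * k by omega), numberLeft, a]
        split_ifs <;> omega) hab
    have hb : ((cyc m₂) ^ (s + 1)).symm ⟨0, by omega⟩ = a := by
      ext
      rw [cyc_symm_pow_val (by omega)]
      simp only [a]
      split_ifs <;> omega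
    have f₂ := (isFusion_amalgam h₂ h₁ hk' (B.map ((cyc m₂) ^ (s + 1))) A).of_map_left
    rw [hb] at f₂
    have f₃ := (f₂.map ((cyc k') ^ S)).isDoubleFusion (a := b)
      (isFusion_amalgam h₃ (by omega) hr' C _)
      (by
        ext
        simp only [Function.comp, cyc_pow_val (show S ≤ 2 * k' by omega),
          cyc_pow_val (show s + 1 ≤ 2 * m₂ by omega), numberLeft, b]
        split_ifs <;> omega) hab.symm
    -- After the rotation by `R`, the order on both sides is: `C`, the vertices `1, …, s` of `B`,
    -- `A`, the vertices of `B` from `s + 2` on.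
    have f₄ := f₁.congr_maps
      (f' := numberRight h₃ hr' ∘ ((cyc k') ^ S) ∘ numberRight h₂ hk')
      (g' := numberRight h₃ hr' ∘ ((cyc k') ^ S) ∘ numberLeft (by omega) ∘ ((cyc m₂) ^ (s + 1)))
      (h' := numberLeft (by omega))
      (by
        intro v hv
        have := v.2
        have : v.1 ≠ 0 := fun h => hv (Fin.ext h)
        ext
        simp only [Function.comp, cyc_pow_val (show S ≤ 2 * k' by omega),
          cyc_pow_val (show R ≤ 2 * r by omega), numberLeft, numberRight]
        split_ifs <;> omega)
      (by
        intro v hv hv'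
        have := v.2
        have : v.1 ≠ s + 1 := fun h => hv (Fin.ext h)
        have : v.1 ≠ 0 := fun h => hv' (Fin.ext h)
        ext
        simp only [Function.comp, cyc_pow_val (show S ≤ 2 * k' by omega),
          cyc_pow_val (show R ≤ 2 * r by omega), cyc_pow_val (show s ≤ 2 * k by omega),
          cyc_pow_val (show s + 1 ≤ 2 * m₂ by omega), numberLeft, numberRight]
        split_ifs <;> omega)
      (by
        intro v hv
        have := v.2
        have : v.1 ≠ 0 := fun h => hv (Fin.ext h)
        ext
        simp only [Function.comp, cyc_pow_val (show s ≤ 2 * k by omega),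
          cyc_pow_val (show R ≤ 2 * r by omega), numberLeft, numberRight]
        split_ifs <;> omega)
    by_cases e : B.partner a = b
    · rw [f₄.eq_of_swap_of_eq f₃ e]
    · rw [f₄.eq_flip_flip_of_swap f₃ e, mk_flip, mk_flip, neg_neg]
  exact LinearMap.congr_fun (LinearMap.congr_fun₂ key x y) z

end OrientedLinear

/-! ### The bracket of homogeneous elements: antisymmetry and the Jacobi identity. -/

open OrientedLinear

theorem rotate_pow_coe {m : ℕ} (x : OrientedChord m) (s : ℕ) : ((rotate m) ^ s) x.1 = x.1 := by
  induction s with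
  | zero => rfl
  | succ s ih => rw [pow_succ, Module.End.mul_apply, show rotate m x.1 = x.1 from x.2, ih]

theorem cyclicSum_rotate {m : ℕ} (x : OrientedLinear m) :
    cyclicSum m (rotate m x) = cyclicSum m x := by
  ext1
  rw [cyclicSum_coe, cyclicSum_coe]
  have h := Finset.sum_range_succ (fun s => ((rotate m) ^ s) x) (2 * m)
  rw [Finset.sum_range_succ', rotate_pow, pow_zero, add_right_cancel_iff] at h
  rw [← h]
  exact Finset.sum_congr rfl fun s _ => by rw [pow_succ, Module.End.mul_apply]

theorem cyclicSum_rotate_pow {m : ℕ} (s : ℕ) (x : OrientedLinear m) :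
    cyclicSum m (((rotate m) ^ s) x) = cyclicSum m x := by
  induction s with
  | zero => rfl
  | succ s ih => rw [pow_succ', Module.End.mul_apply, cyclicSum_rotate, ih]

theorem homBracket_apply {m l k : ℕ} (hm : 0 < m) (hl : 0 < l) (h : m + l = k + 1)
    (x : OrientedChord m) (y : OrientedChord l) :
    homBracket hm hl h x y = cyclicSum k (amalgamLinear hm hl h x.1 y.1) := rfl

theorem homBracket_swap {m l k : ℕ} (hm : 0 < m) (hl : 0 < l) (h : m + l = k + 1)
    (h' : l + m = k + 1) (x : OrientedChord m) (y : OrientedChord l) :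
    homBracket hm hl h x y = -homBracket hl hm h' y x := by
  rw [homBracket_apply, homBracket_apply, ← map_neg, ← amalgamLinear_swap hm hl h h',
    cyclicSum_rotate_pow]

/-- The part of `[x, [y, z]]` in which `y` is fused with both `x` and `z`. -/
noncomputable def midBracket {m₁ m₂ m₃ k r : ℕ} (h₁ : 0 < m₁) (h₂ : 0 < m₂) (h₃ : 0 < m₃)
    (hk : m₂ + m₃ = k + 1) (hr : m₁ + k = r + 1) (x : OrientedChord m₁) (y : OrientedChord m₂) (z : OrientedChord m₃) :
    OrientedChord r :=
  ∑ s ∈ Finset.range (2 * m₂ - 1), cyclicSum r (amalgamLinear h₁ (by omega) hr x.1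
    (((rotate k) ^ s) (amalgamLinear h₂ h₃ hk y.1 z.1)))

/-- The reassociation matches the summand `s` with the summand `2 * m₂ - 2 - s`. The rotation of `y`
that it introduces disappears because `y` is invariant. -/
theorem midBracket_swap {m₁ m₂ m₃ k k' r : ℕ} (h₁ : 0 < m₁) (h₂ : 0 < m₂) (h₃ : 0 < m₃)
    (hk : m₂ + m₃ = k + 1) (hk' : m₂ + m₁ = k' + 1) (hr : m₁ + k = r + 1) (hr' : m₃ + k' = r + 1)
    (x : OrientedChord m₁) (y : OrientedChord m₂) (z : OrientedChord m₃) :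
    midBracket h₁ h₂ h₃ hk hr x y z = midBracket h₃ h₂ h₁ hk' hr' z y x := by
  unfold midBracket
  rw [← Finset.sum_range_reflect (fun s => cyclicSum r (amalgamLinear h₃ _ hr' z.1
    (((rotate k') ^ s) (amalgamLinear h₂ h₁ hk' y.1 x.1))))]
  refine Finset.sum_congr rfl fun s hs => ?_
  have hs' : s + 1 < 2 * m₂ := by have := Finset.mem_range.1 hs; omega
  have h := amalgamLinear_amalgamLinear h₁ h₂ h₃ hk hk' hr hr' hs' x.1 y.1 z.1
  rw [rotate_pow_coe] at h
  rw [← cyclicSum_rotate_pow (2 * m₁ - 1 + (2 * m₂ - s - 2)), h,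
    show 2 * m₂ - 1 - 1 - s = 2 * m₂ - s - 2 by omega]

theorem homBracket_homBracket {m₁ m₂ m₃ k r : ℕ} (h₁ : 0 < m₁) (h₂ : 0 < m₂) (h₃ : 0 < m₃)
    (hk : m₂ + m₃ = k + 1) (hk' : m₃ + m₂ = k + 1) (hk0 : 0 < k) (hr : m₁ + k = r + 1)
    (x : OrientedChord m₁) (y : OrientedChord m₂) (z : OrientedChord m₃) :
    homBracket h₁ hk0 hr x (homBracket h₂ h₃ hk y z) =
      midBracket h₁ h₂ h₃ hk hr x y z - midBracket h₁ h₃ h₂ hk' hr x z y := by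
  -- The first `2 * m₂ - 1` rotations of `y * z` put a vertex of `y` in front, the other `2 * m₃ -
  -- 1` a vertex of `z`. The latter are rotations of `-(z * y)`.
  rw [homBracket_apply, homBracket_apply, cyclicSum_coe, map_sum, map_sum,
    show 2 * k = (2 * m₂ - 1) + (2 * m₃ - 1) by omega, Finset.sum_range_add, sub_eq_add_neg]
  unfold midBracket
  rw [← Finset.sum_neg_distrib]
  congr 1
  refine Finset.sum_congr rfl fun s _ => ?_
  rw [add_comm, pow_add, Module.End.mul_apply, amalgamLinear_swap h₂ h₃ hk hk', map_neg, map_neg,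
    map_neg]

theorem homBracket_jacobi {m₁ m₂ m₃ k₁ k₂ k₃ r : ℕ} (h₁ : 0 < m₁) (h₂ : 0 < m₂) (h₃ : 0 < m₃)
    (hk₁ : m₂ + m₃ = k₁ + 1) (hk₂ : m₁ + m₃ = k₂ + 1) (hk₃ : m₁ + m₂ = k₃ + 1)
    (p₁ : 0 < k₁) (p₂ : 0 < k₂) (p₃ : 0 < k₃)
    (hr₁ : m₁ + k₁ = r + 1) (hr₂ : m₂ + k₂ = r + 1) (hr₃ : k₃ + m₃ = r + 1)
    (x : OrientedChord m₁) (y : OrientedChord m₂) (z : OrientedChord m₃) :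
    homBracket h₁ p₁ hr₁ x (homBracket h₂ h₃ hk₁ y z) =
      homBracket p₃ h₃ hr₃ (homBracket h₁ h₂ hk₃ x y) z +
        homBracket h₂ p₂ hr₂ y (homBracket h₁ h₃ hk₂ x z) := by
  have a₁ : m₃ + m₂ = k₁ + 1 := by omega
  have a₂ : m₃ + m₁ = k₂ + 1 := by omega
  have a₃ : m₂ + m₁ = k₃ + 1 := by omega
  have b₃ : m₃ + k₃ = r + 1 := by omega
  -- All brackets become differences of two `midBracket` terms, and the symmetry of `midBracket` in
  -- its outer arguments leaves only three different ones.
  rw [homBracket_swap p₃ h₃ hr₃ b₃, homBracket_homBracket h₁ h₂ h₃ hk₁ a₁,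
    homBracket_homBracket h₃ h₁ h₂ hk₃ a₃, homBracket_homBracket h₂ h₁ h₃ hk₂ a₂,
    midBracket_swap h₁ h₂ h₃ hk₁ a₃ hr₁ b₃, midBracket_swap h₁ h₃ h₂ a₁ a₂ hr₁ hr₂,
    midBracket_swap h₃ h₁ h₂ hk₃ hk₂ b₃ hr₂]
  abel

/-! ### From homogeneous elements to the product. -/

theorem chordBracket_apply (X Y : ChordAlgebra) (k : {m : ℕ // 2 ≤ m}) :
    chordBracket X Y k = ∑ p ∈ (Finset.HasAntidiagonal.antidiagonal (k.1 + 1)).attach,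
      if h : 2 ≤ p.1.1 ∧ 2 ≤ p.1.2 then
        homBracket (by omega) (by omega) (Finset.HasAntidiagonal.mem_antidiagonal.1 p.2)
          (X ⟨p.1.1, h.1⟩) (Y ⟨p.1.2, h.2⟩)
      else 0 := rfl

theorem chordBracket_swap (X Y : ChordAlgebra) : chordBracket X Y = -chordBracket Y X := by
  funext k
  rw [Pi.neg_apply, chordBracket_apply, chordBracket_apply, ← Finset.sum_neg_distrib]
  refine Finset.sum_bij' (fun p _ => ⟨p.1.swap, by
      have := Finset.HasAntidiagonal.mem_antidiagonal.1 p.2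
      exact Finset.HasAntidiagonal.mem_antidiagonal.2 (by simp only [Prod.fst_swap, Prod.snd_swap]; omega)⟩)
    (fun p _ => ⟨p.1.swap, by
      have := Finset.HasAntidiagonal.mem_antidiagonal.1 p.2
      exact Finset.HasAntidiagonal.mem_antidiagonal.2 (by simp only [Prod.fst_swap, Prod.snd_swap]; omega)⟩)
    (fun _ _ => Finset.mem_attach _ _) (fun _ _ => Finset.mem_attach _ _)
    (fun _ _ => rfl) (fun _ _ => rfl) ?_
  intro p _
  by_cases h : 2 ≤ p.1.1 ∧ 2 ≤ p.1.2
  · rw [dif_pos h, dif_pos (show 2 ≤ p.1.swap.1 ∧ 2 ≤ p.1.swap.2 from ⟨h.2, h.1⟩)]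
    exact homBracket_swap _ _ _ _ _ _
  · rw [dif_neg h, dif_neg (show ¬ (2 ≤ p.1.swap.1 ∧ 2 ≤ p.1.swap.2) from fun h' => h ⟨h'.2, h'.1⟩),
      neg_zero]

theorem chordBracket_self (X : ChordAlgebra) : chordBracket X X = 0 := by
  funext k
  have h : chordBracket X X k = -(chordBracket X X k) := congrFun (chordBracket_swap X X) k
  have h2 : (2 : ℚ) • chordBracket X X k = 0 := by
    rw [two_smul]
    exact eq_neg_iff_add_eq_zero.1 h
  exact (smul_eq_zero.1 h2).resolve_left (by norm_num)

theorem chordBracket_single_right (X : ChordAlgebra) {m l k : ℕ} (hm : 2 ≤ m) (hl : 2 ≤ l)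
    (hk : 2 ≤ k) (h : m + l = k + 1) (y : OrientedChord l) :
    chordBracket X (Pi.single ⟨l, hl⟩ y) ⟨k, hk⟩ =
      homBracket (by omega) (by omega) h (X ⟨m, hm⟩) y := by
  rw [chordBracket_apply, Finset.sum_eq_single ⟨(m, l), Finset.HasAntidiagonal.mem_antidiagonal.2 h⟩]
  · rw [dif_pos ⟨hm, hl⟩, Pi.single_eq_same]
  · rintro ⟨⟨a, b⟩, hab⟩ _ hne
    have hab' := Finset.HasAntidiagonal.mem_antidiagonal.1 hab
    split_ifs with h'
    · rw [Pi.single_eq_of_ne, map_zero]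
      intro hb
      have hb' : b = l := congrArg Subtype.val hb
      apply hne
      simp only at hab'
      simp only [Subtype.mk.injEq, Prod.mk.injEq]
      omega
    · rfl
  · intro h'
    exact absurd (Finset.mem_attach _ _) h'

theorem chordBracket_single_single {m l k : ℕ} (hm : 2 ≤ m) (hl : 2 ≤ l) (hk : 2 ≤ k)
    (h : m + l = k + 1) (x : OrientedChord m) (y : OrientedChord l) :
    chordBracket (Pi.single ⟨m, hm⟩ x) (Pi.single ⟨l, hl⟩ y) =
      Pi.single ⟨k, hk⟩ (homBracket (by omega) (by omega) h x y) := by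
  funext ⟨j, hj⟩
  by_cases hjk : j = k
  · subst hjk
    rw [chordBracket_single_right _ hm hl hj h, Pi.single_eq_same, Pi.single_eq_same]
  · rw [Pi.single_eq_of_ne (by simpa using hjk), chordBracket_apply]
    refine Finset.sum_eq_zero ?_
    rintro ⟨⟨a, b⟩, hab⟩ _
    have hab' := Finset.HasAntidiagonal.mem_antidiagonal.1 hab
    simp only at hab'
    split_ifs with h'
    · by_cases hb : b = l
      · rw [Pi.single_eq_of_ne (i := (⟨m, hm⟩ : {m : ℕ // 2 ≤ m})), map_zero,
          LinearMap.zero_apply]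
        intro ha
        have ha' : a = m := congrArg Subtype.val ha
        omega
      · rw [Pi.single_eq_of_ne (i := (⟨l, hl⟩ : {m : ℕ // 2 ≤ m})), map_zero]
        intro hb'
        exact hb (congrArg Subtype.val hb')
    · rfl

/-- Both degrees in `m + l = k + 1` are at least `2`, so neither exceeds `k`. This allows identities
to be checked on truncations. -/
theorem chordBracket_congr {X X' Y Y' : ChordAlgebra} {K : ℕ} (hX : ∀ i, i.1 ≤ K → X i = X' i)
    (hY : ∀ i, i.1 ≤ K → Y i = Y' i) (k : {m : ℕ // 2 ≤ m}) (hk : k.1 ≤ K) :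
    chordBracket X Y k = chordBracket X' Y' k := by
  rw [chordBracket_apply, chordBracket_apply]
  refine Finset.sum_congr rfl ?_
  rintro ⟨⟨a, b⟩, hab⟩ _
  have hab' := Finset.HasAntidiagonal.mem_antidiagonal.1 hab
  simp only at hab'
  split_ifs with h'
  · simp only at h'
    rw [hX _ (by simp only; omega), hY _ (by simp only; omega)]
  · rfl

/-- Every element of `𝓒` agrees with a finite sum of homogeneous ones up to a given degree. -/
theorem exists_mem_span_single_eq (X : ChordAlgebra) (K : ℕ) :
    ∃ X' ∈ Submodule.span ℚ {x : ChordAlgebra | ∃ i a, x = Pi.single i a},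
      ∀ i, i.1 ≤ K → X i = X' i := by
  refine ⟨∑ i ∈ (Finset.range (K + 1)).subtype (fun m => 2 ≤ m), Pi.single i (X i),
    Submodule.sum_mem _ fun i _ => Submodule.subset_span ⟨i, _, rfl⟩, ?_⟩
  intro i hi
  rw [Finset.sum_apply, Finset.sum_eq_single i]
  · rw [Pi.single_eq_same]
  · intro j _ hj
    rw [Pi.single_eq_of_ne hj.symm]
  · intro h
    exact absurd (Finset.mem_subtype.2 (Finset.mem_range.2 (by omega))) h

theorem chordBracket_jacobi_single (i j l : {m : ℕ // 2 ≤ m}) (x : OrientedChord i.1)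
    (y : OrientedChord j.1) (z : OrientedChord l.1) :
    chordBracket (Pi.single i x) (chordBracket (Pi.single j y) (Pi.single l z)) =
      chordBracket (chordBracket (Pi.single i x) (Pi.single j y)) (Pi.single l z) +
        chordBracket (Pi.single j y) (chordBracket (Pi.single i x) (Pi.single l z)) := by
  obtain ⟨i, hi⟩ := i
  obtain ⟨j, hj⟩ := j
  obtain ⟨l, hl⟩ := l
  rw [chordBracket_single_single (k := j + l - 1) hj hl (by omega) (by omega),
    chordBracket_single_single (k := i + j - 1) hi hj (by omega) (by omega),
    chordBracket_single_single (k := i + l - 1) hi hl (by omega) (by omega),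
    chordBracket_single_single (k := i + j + l - 2) hi (by omega) (by omega) (by omega),
    chordBracket_single_single (k := i + j + l - 2) (by omega) hl (by omega) (by omega),
    chordBracket_single_single (k := i + j + l - 2) hj (by omega) (by omega) (by omega),
    ← Pi.single_add, homBracket_jacobi (k₂ := i + l - 1) (k₃ := i + j - 1)]

/-- Homogeneous elements do not span the product, so the identity is proved on their span and then,
in each degree `k`, for truncations at `k`. -/
theorem chordBracket_jacobi (X Y Z : ChordAlgebra) :
    chordBracket X (chordBracket Y Z) =
      chordBracket (chordBracket X Y) Z + chordBracket Y (chordBracket X Z) := by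
  have key : ∀ X ∈ Submodule.span ℚ {x : ChordAlgebra | ∃ i a, x = Pi.single i a},
      ∀ Y ∈ Submodule.span ℚ {x : ChordAlgebra | ∃ i a, x = Pi.single i a},
      ∀ Z ∈ Submodule.span ℚ {x : ChordAlgebra | ∃ i a, x = Pi.single i a},
      chordBracket X (chordBracket Y Z) =
        chordBracket (chordBracket X Y) Z + chordBracket Y (chordBracket X Z) := by
    intro X hX Y hY Z hZ
    induction hX using Submodule.span_induction with
    | zero => simp
    | add _ _ _ _ h1 h2 => simp only [map_add, LinearMap.add_apply, h1, h2]; abel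
    | smul c _ _ h => simp only [map_smul, LinearMap.smul_apply, h, smul_add]
    | mem X hX =>
      induction hY using Submodule.span_induction with
      | zero => simp
      | add _ _ _ _ h1 h2 => simp only [map_add, LinearMap.add_apply, h1, h2]; abel
      | smul c _ _ h => simp only [map_smul, LinearMap.smul_apply, h, smul_add]
      | mem Y hY =>
        induction hZ using Submodule.span_induction with
        | zero => simp
        | add _ _ _ _ h1 h2 => simp only [map_add, h1, h2]; abel
        | smul c _ _ h => simp only [map_smul, h, smul_add]
        | mem Z hZ =>
          obtain ⟨i, x, rfl⟩ := hX
          obtain ⟨j, y, rfl⟩ := hY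
          obtain ⟨l, z, rfl⟩ := hZ
          exact chordBracket_jacobi_single i j l x y z
  funext k
  obtain ⟨X', hX', eX⟩ := exists_mem_span_single_eq X k.1
  obtain ⟨Y', hY', eY⟩ := exists_mem_span_single_eq Y k.1
  obtain ⟨Z', hZ', eZ⟩ := exists_mem_span_single_eq Z k.1
  rw [Pi.add_apply, chordBracket_congr eX (chordBracket_congr eY eZ) k le_rfl,
    chordBracket_congr (chordBracket_congr eX eY) eZ k le_rfl,
    chordBracket_congr eY (chordBracket_congr eX eZ) k le_rfl, key X' hX' Y' hY' Z' hZ',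
    Pi.add_apply]

/-! ### Centrality of `Ω_m`: fusion with an isolated chord. -/

namespace LabeledDiagram

namespace IsFusion

variable {V W X : Type} {C : LabeledDiagram V} {D : LabeledDiagram W} {E E' : LabeledDiagram X}
  {f f' : V → X} {g g' : W → X} {p p' : V} {q q' : W}

/-- Fusing with a chord of `C` amounts to deleting that chord and keeping all of `D`, with `q` moved
to the free end `C.partner p`. The chord of `D` through `q` gets reversed exactly when `p` is a
tail. -/
theorem absorb [DecidableEq W] (h : IsFusion C p D q E f g) {G : W → X} (hq : G q = f (C.partner p))
    (hG : ∀ w, w ≠ q → G w = g w) (w : W) : E.partner (G w) = G (D.partner w) ∧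
      E.isTail (G w) = (xor (decide (w = q ∨ D.partner w = q) && C.isTail p) (D.isTail w)) := by
  have hD := D.partner_partner
  have hDn := D.partner_ne
  by_cases h1 : w = q
  · subst h1
    rw [hG _ (hDn w), hq, h.partner_fused, h.isTail_fused]
    simp
  · by_cases h2 : D.partner w = q
    · obtain rfl : w = D.partner q := by grind
      rw [hG _ h1, hD, hq, h.partner_fused', h.isTail_fused', D.isTail_partner]
      simp
    · rw [hG _ h1, hG _ h2, h.partner_right w h1 h2, h.isTail_right w h1 h2]
      simp [h1, h2]

/-- Fusing `D` with the two ends of one chord of `C` gives, up to the position of the remaining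
vertices, opposite results. -/
theorem eq_flip_of_absorb [DecidableEq X] (h : IsFusion C p D q E f g)
    (h' : IsFusion C p' D q' E' f' g') (hp : C.partner p = p') (ht : C.isTail p = true)
    (hf : ∀ v, v ≠ p → v ≠ p' → f v = f' v) {G : W → X} (hGq : G q = f p')
    (hG : ∀ w, w ≠ q → G w = g w) (hGq' : G q' = f' p) (hG' : ∀ w, w ≠ q' → G w = g' w) :
    E' = E.flip (G q) := by
  classical
  subst hp
  have hC := C.partner_partner
  have hCn := C.partner_ne
  have hD := D.partner_partner
  have ht' : C.isTail (C.partner p) = false := by rw [C.isTail_partner, ht]; rfl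
  have k := h.absorb hGq hG
  have k' := h'.absorb (by rw [hGq', hC]) hG'
  have inj : ∀ w, G w = G q ↔ w = q := by
    intro w
    refine ⟨fun hw => ?_, fun hw => by rw [hw]⟩
    by_contra hne
    rw [hG w hne, hGq] at hw
    exact h.disjoint _ _ (hCn p) hne hw.symm
  have cov : ∀ x, (∃ v, v ≠ p ∧ v ≠ C.partner p ∧ f v = x) ∨ ∃ w, G w = x := by
    intro x
    rcases h.cover x with ⟨v, hv, rfl⟩ | ⟨w, hw, rfl⟩
    · by_cases hv' : v = C.partner p
      · exact Or.inr ⟨q, by rw [hGq, hv']⟩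
      · exact Or.inl ⟨v, hv, hv', rfl⟩
    · exact Or.inr ⟨w, hG w hw⟩
  ext x
  · change _ = E.partner x
    rcases cov x with ⟨v, hv, hv', rfl⟩ | ⟨w, rfl⟩
    · rw [h.partner_left v hv (by grind), hf v hv hv', h'.partner_left v hv' (by grind),
        hf _ (by grind) (by grind)]
    · rw [(k w).1, (k' w).1]
  · rw [isTail_flip]
    rcases cov x with ⟨v, hv, hv', rfl⟩ | ⟨w, rfl⟩
    · rw [h.isTail_left v hv (by grind), h.partner_left v hv (by grind), hGq]
      have a1 : f v ≠ f (C.partner p) := fun hh => hv' (h.inj_left _ _ hv (hCn p) hh)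
      have a2 : f (C.partner v) ≠ f (C.partner p) := fun hh => by
        have := h.inj_left _ _ (by grind) (hCn p) hh
        grind
      rw [hf v hv hv', h'.isTail_left v hv' (by grind)]
      rw [hf v hv hv'] at a1
      simp [a1, a2]
    · rw [(k w).1, (k w).2, (k' w).2, ht, ht']
      simp [inj]

end IsFusion

end LabeledDiagram

theorem isolatedLinear_partner_val {m : ℕ} (v : Fin (2 * m)) :
    ((isolatedLinear m).partner v).1 = if v.1 % 2 = 0 then v.1 + 1 else v.1 - 1 := by
  unfold isolatedLinear
  split_ifs with h <;> simp [h]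

theorem isolatedLinear_map_cyc_sq (m : ℕ) :
    (isolatedLinear m).map ((cyc m) ^ 2) = isolatedLinear m := by
  rcases Nat.eq_zero_or_pos m with rfl | hm
  · ext v <;> exact v.elim0
  ext v
  · have := v.2
    simp only [map]
    rw [cyc_pow_val (show 2 ≤ 2 * m by omega), isolatedLinear_partner_val,
      isolatedLinear_partner_val, cyc_symm_pow_val (show 2 ≤ 2 * m by omega)]
    split_ifs <;> omega
  · have := v.2
    simp only [map, isolatedLinear, cyc_symm_pow_val (show 2 ≤ 2 * m by omega)]
    congr 1
    split_ifs <;> simp only [eq_iff_iff] <;> omega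

theorem rotate_sq_isolated (m : ℕ) :
    rotate m (rotate m (mk (isolatedLinear m))) = mk (isolatedLinear m) := by
  have h := rotate_pow_mk m 2 (isolatedLinear m)
  rw [isolatedLinear_map_cyc_sq, pow_two, Module.End.mul_apply] at h
  exact h

theorem Omega_coe (m : ℕ) : (Omega m).1 =
    (m : ℚ) • (mk (isolatedLinear m) + rotate m (mk (isolatedLinear m))) := by
  have h : ∀ n : ℕ, ∑ s ∈ Finset.range (2 * n), ((rotate m) ^ s) (mk (isolatedLinear m)) =
      (n : ℚ) • (mk (isolatedLinear m) + rotate m (mk (isolatedLinear m))) ∧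
      ((rotate m) ^ (2 * n)) (mk (isolatedLinear m)) = mk (isolatedLinear m) := by
    intro n
    induction n with
    | zero => simp
    | succ n ih =>
      rw [show 2 * (n + 1) = 2 * n + 1 + 1 by ring, Finset.sum_range_succ, Finset.sum_range_succ,
        pow_succ' _ (2 * n + 1), Module.End.mul_apply, pow_succ' _ (2 * n), Module.End.mul_apply,
        ih.1, ih.2]
      refine ⟨?_, rotate_sq_isolated m⟩
      push_cast
      rw [add_smul, one_smul, add_assoc]
  rw [Omega, cyclicSum_coe, (h m).1]

/-- Vertices `0` and `1` of the isolated diagram are the tail and head of one chord. Fusing the tail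
with vertex `0` of `D`, or the head with vertex `1` of `D`, cuts `D` at the same place, between `0`
and `1`. The results differ by a rotation and the reversal of one chord. -/
theorem amalgamLinear_rotate_isolated {m l k : ℕ} (hm : 0 < m) (hl : 0 < l) (h : m + l = k + 1)
    (y : OrientedLinear l) :
    amalgamLinear hm hl h (rotate m (mk (isolatedLinear m))) (rotate l y) =
      -rotate k (amalgamLinear hm hl h (mk (isolatedLinear m)) y) := by
  have key : (amalgamLinear hm hl h (rotate m (mk (isolatedLinear m)))).comp (rotate l) =
      -(rotate k).comp (amalgamLinear hm hl h (mk (isolatedLinear m))) := by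
    refine hom_ext fun D => ?_
    have r1 : ∀ {n : ℕ} (C : LinearDiagram n), rotate n (mk C) = mk (C.map ((cyc n) ^ 1)) := by
      intro n C
      rw [← rotate_pow_mk, pow_one]
    simp only [LinearMap.comp_apply, LinearMap.neg_apply, r1, amalgamLinear_mk]
    have f₁ := (isFusion_amalgam hm hl h (isolatedLinear m) D).map ((cyc k) ^ 1)
    have f₂ := (isFusion_amalgam hm hl h ((isolatedLinear m).map ((cyc m) ^ 1))
      (D.map ((cyc l) ^ 1))).of_map_left.of_map_right
    have hs : ∀ (n : ℕ) (hn : 0 < n),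
        ((cyc n) ^ 1).symm (⟨0, by omega⟩ : Fin (2 * n)) = ⟨1, by omega⟩ := by
      intro n hn
      ext
      rw [cyc_symm_pow_val (by omega)]
      simp only
      split_ifs <;> omega
    rw [hs m hm, hs l hl] at f₂
    -- Common position of `D` in both results: the vertices `1, …, 2l - 1, 0`, in this order, fill
    -- the places from `2m - 2` to `2k - 1`.
    let G : Fin (2 * l) → Fin (2 * k) := fun w =>
      if h0 : w.1 = 0 then ⟨2 * k - 1, by omega⟩ else ⟨w.1 + 2 * m - 3, by have := w.2; omega⟩
    rw [f₁.eq_flip_of_absorb f₂ (G := G) ?_ ?_ ?_ ?_ ?_ ?_ ?_, mk_flip]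
    · simp [isolatedLinear]
    · simp [isolatedLinear]
    · intro v h1 h2
      have := v.2
      have : v.1 ≠ 0 := fun h => h1 (Fin.ext h)
      have : v.1 ≠ 1 := fun h => h2 (Fin.ext h)
      ext
      simp only [Function.comp, cyc_pow_val (show 1 ≤ 2 * k by omega),
        cyc_pow_val (show 1 ≤ 2 * m by omega), numberLeft]
      split_ifs <;> omega
    · ext
      simp only [Function.comp, cyc_pow_val (show 1 ≤ 2 * k by omega), numberLeft, G]
      split_ifs <;> simp only <;> omega
    · intro v h1
      have := v.2
      have : v.1 ≠ 0 := fun h => h1 (Fin.ext h)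
      ext
      simp only [Function.comp, cyc_pow_val (show 1 ≤ 2 * k by omega), numberRight, G]
      split_ifs <;> simp only <;> omega
    · ext
      simp only [Function.comp, cyc_pow_val (show 1 ≤ 2 * m by omega), numberLeft, G]
      split_ifs <;> first | contradiction | (simp only; omega)
    · intro v h1
      have := v.2
      have : v.1 ≠ 1 := fun h => h1 (Fin.ext h)
      ext
      simp only [Function.comp, cyc_pow_val (show 1 ≤ 2 * l by omega), numberRight, G]
      split_ifs <;> simp only <;> omega
  exact LinearMap.congr_fun key y

/-- `Ω_m` is a multiple of `I_m + ν I_m`. Since `y` is invariant, its amalgamations with `I_m` and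
`ν I_m` are opposite up to a rotation, which `N` does not see. -/
theorem homBracket_Omega {m l k : ℕ} (hm : 0 < m) (hl : 0 < l) (h : m + l = k + 1)
    (y : OrientedChord l) : homBracket hm hl h (Omega m) y = 0 := by
  have h1 := amalgamLinear_rotate_isolated hm hl h y.1
  rw [show rotate l y.1 = y.1 from y.2] at h1
  rw [homBracket_apply, Omega_coe, map_smul, LinearMap.smul_apply, map_add, LinearMap.add_apply, h1,
    map_smul, map_add, map_neg, cyclicSum_rotate, add_neg_cancel, smul_zero]

/-! ### Recovering diagrams from fusions, and coefficients of diagrams. -/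

namespace LabeledDiagram

/-- A fusion determines the pairings of the two diagrams. -/
theorem IsFusion.partner_eq {V W X : Type} {C C' : LabeledDiagram V} {D D' : LabeledDiagram W}
    {E E' : LabeledDiagram X} {f : V → X} {g : W → X} {p : V} {q : W}
    (h : IsFusion C p D q E f g) (h' : IsFusion C' p D' q E' f g) (e : E.partner = E'.partner) :
    C.partner = C'.partner ∧ D.partner = D'.partner := by
  -- The fused chord is the only one joining the image of `f` to that of `g`, so the equality of
  -- pairings forces the fused ends to correspond.
  have left : ∀ v, v ≠ p → C.partner v = C'.partner v := by
    intro v hv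
    have hE := congrFun e (f v)
    by_cases h1 : C.partner v = p <;> by_cases h2 : C'.partner v = p
    · rw [h1, h2]
    · have hv' : C.partner p = v := by rw [← h1, C.partner_partner]
      rw [h'.partner_left v hv h2, ← hv', h.partner_fused, hv'] at hE
      exact absurd hE.symm (h.disjoint _ _ h2 (D.partner_ne q))
    · have hv' : C'.partner p = v := by rw [← h2, C'.partner_partner]
      rw [h.partner_left v hv h1, ← hv', h'.partner_fused, hv'] at hE
      exact absurd hE (h.disjoint _ _ h1 (D'.partner_ne q))
    · rw [h.partner_left v hv h1, h'.partner_left v hv h2] at hE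
      exact h.inj_left _ _ h1 h2 hE
  have right : ∀ w, w ≠ q → D.partner w = D'.partner w := by
    intro w hw
    have hE := congrFun e (g w)
    by_cases h1 : D.partner w = q <;> by_cases h2 : D'.partner w = q
    · rw [h1, h2]
    · have hw' : D.partner q = w := by rw [← h1, D.partner_partner]
      rw [h'.partner_right w hw h2, ← hw', h.partner_fused', hw'] at hE
      exact absurd hE (h.disjoint _ _ (C.partner_ne p) h2)
    · have hw' : D'.partner q = w := by rw [← h2, D'.partner_partner]
      rw [h.partner_right w hw h1, ← hw', h'.partner_fused', hw'] at hE
      exact absurd hE.symm (h.disjoint _ _ (C'.partner_ne p) h1)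
    · rw [h.partner_right w hw h1, h'.partner_right w hw h2] at hE
      exact h.inj_right _ _ h1 h2 hE
  constructor
  · funext v
    by_cases hv : v = p
    · subst hv
      have := left _ (C.partner_ne v)
      rw [C.partner_partner] at this
      nth_rewrite 2 [this]
      rw [C'.partner_partner]
    · exact left v hv
  · funext w
    by_cases hw : w = q
    · subst hw
      have := right _ (D.partner_ne w)
      rw [D.partner_partner] at this
      nth_rewrite 2 [this]
      rw [D'.partner_partner]
    · exact right w hw

/-- The sign relating two orientations of the chords of the same diagram. -/
def sign {V : Type} [Fintype V] (F C : LabeledDiagram V) : ℚ :=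
  ∏ v, if F.isTail v = true ∧ C.isTail v = false then -1 else 1

theorem sign_self {V : Type} [Fintype V] (F : LabeledDiagram V) : sign F F = 1 := by
  refine Finset.prod_eq_one fun v _ => ?_
  rw [if_neg]
  simp

theorem sign_map {V W : Type} [Fintype V] [Fintype W] (e : V ≃ W) (F C : LabeledDiagram V) :
    sign (F.map e) (C.map e) = sign F C :=
  e.symm.prod_comp fun v => if F.isTail v = true ∧ C.isTail v = false then (-1 : ℚ) else 1

theorem sign_flip {V : Type} [Fintype V] [DecidableEq V] {F C : LabeledDiagram V}
    (h : C.partner = F.partner) (v : V) : sign F (C.flip v) = -sign F C := by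
  -- Each chord contributes to the product only through its tail in `F`, so only the factor at the
  -- `F`-tail `t` of the reversed chord changes.
  obtain ⟨t, ht, htv⟩ : ∃ t, F.isTail t = true ∧ (t = v ∨ C.partner t = v) := by
    by_cases hv : F.isTail v = true
    · exact ⟨v, hv, Or.inl rfl⟩
    · refine ⟨C.partner v, ?_, Or.inr (C.partner_partner v)⟩
      rw [h, F.isTail_partner]
      simpa using hv
  unfold sign
  rw [← Finset.mul_prod_erase _ _ (Finset.mem_univ t), ← Finset.mul_prod_erase Finset.univ
    (fun v => if F.isTail v = true ∧ C.isTail v = false then (-1 : ℚ) else 1) (Finset.mem_univ t), ← neg_mul]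
  congr 1
  · rw [isTail_flip, ht]
    cases C.isTail t <;> simp [htv]
  · refine Finset.prod_congr rfl fun w hw => ?_
    have hwt := Finset.ne_of_mem_erase hw
    by_cases hwv : w = v ∨ C.partner w = v
    · have hC := C.partner_partner
      have hw' : w = C.partner t := by grind
      have : F.isTail w = false := by rw [hw', h, F.isTail_partner, ht]; rfl
      simp [this]
    · rw [isTail_flip]
      simp [hwv]

end LabeledDiagram

namespace OrientedLinear

/-- The coefficient of the diagram `F`. -/
noncomputable def coeff {m : ℕ} (F : LinearDiagram m) : OrientedLinear m →ₗ[ℚ] ℚ :=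
  lift (fun C => if C.partner = F.partner then F.sign C else 0) (fun C v => by
    by_cases h : C.partner = F.partner
    · rw [if_pos h, if_pos (show (C.flip v).partner = F.partner from h), sign_flip h]
    · rw [if_neg h, if_neg (show ¬ (C.flip v).partner = F.partner from h), neg_zero])

theorem coeff_mk {m : ℕ} (F C : LinearDiagram m) :
    coeff F (mk C) = if C.partner = F.partner then F.sign C else 0 := by
  simp [coeff]

theorem coeff_mk_self {m : ℕ} (F : LinearDiagram m) : coeff F (mk F) = 1 := by
  rw [coeff_mk, if_pos rfl, sign_self]

theorem coeff_map_mk_map {m : ℕ} (e : Equiv.Perm (Fin (2 * m))) (F C : LinearDiagram m) :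
    coeff (F.map e) (mk (C.map e)) = coeff F (mk C) := by
  rw [coeff_mk, coeff_mk, sign_map]
  congr 1
  rw [eq_iff_iff]
  constructor
  · intro h
    funext v
    have := congrFun h (e v)
    simpa [map] using this
  · intro h
    simp [map, h]

theorem coeff_map_rotate {m : ℕ} (s : ℕ) (F : LinearDiagram m) (x : OrientedLinear m) :
    coeff (F.map ((cyc m) ^ s)) (((rotate m) ^ s) x) = coeff F x := by
  have key : (coeff (F.map ((cyc m) ^ s))).comp ((rotate m) ^ s) = coeff F := by
    refine hom_ext fun C => ?_
    rw [LinearMap.comp_apply, rotate_pow_mk, coeff_map_mk_map]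
  exact LinearMap.congr_fun key x

/-- Diagrams with the same unoriented chords are proportional. -/
theorem mk_eq_coeff_smul {m : ℕ} {F C : LinearDiagram m} (h : C.partner = F.partner) :
    mk C = coeff F (mk C) • mk F := by
  -- Induction on the number of vertices at which the orientations differ; reversing one such chord
  -- lowers it.
  induction hn : (Finset.univ.filter fun v => C.isTail v ≠ F.isTail v).card
    using Nat.strong_induction_on generalizing C with
  | _ n ih =>
    by_cases hC : ∃ v, C.isTail v ≠ F.isTail v
    · obtain ⟨v, hv⟩ := hC
      have h1 := ih _ (by
        rw [← hn]
        refine Finset.card_lt_card (Finset.ssubset_iff_of_subset ?_ |>.2 ⟨v, ?_, ?_⟩)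
        · intro w hw
          simp only [Finset.mem_filter, Finset.mem_univ, true_and] at hw ⊢
          by_cases hwv : w = v ∨ C.partner w = v
          · rcases hwv with rfl | rfl
            · exact hv
            · rw [h, F.isTail_partner, ← h, C.isTail_partner] at hv
              simpa using hv
          · rw [isTail_flip] at hw
            simpa [hwv] using hw
        · simpa using hv
        · rw [Finset.mem_filter, isTail_flip]
          simp only [Finset.mem_univ, true_or, decide_true, true_and, ne_eq, not_not]
          revert hv
          cases C.isTail v <;> cases F.isTail v <;> simp) (C := C.flip v) h rfl
      rw [mk_flip, map_neg, neg_smul, neg_inj] at h1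
      exact h1
    · push Not at hC
      obtain rfl : C = F := LabeledDiagram.ext h (funext hC)
      rw [coeff_mk_self, one_smul]

end OrientedLinear

/-- The pairings of the vertices of a linear chord diagram. -/
abbrev Pairing (m : ℕ) : Type :=
  {μ : Fin (2 * m) → Fin (2 * m) // (∀ v, μ (μ v) = v) ∧ ∀ v, μ v ≠ v}

/-- A pairing with its chords oriented upwards. -/
def Pairing.diagram {m : ℕ} (μ : Pairing m) : LinearDiagram m where
  partner := μ.1
  isTail v := decide (v < μ.1 v)
  partner_partner := μ.2.1
  partner_ne := μ.2.2
  isTail_partner v := by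
    rw [μ.2.1]
    rcases lt_or_gt_of_ne (μ.2.2 v) with h | h <;> simp [h, h.le]

theorem OrientedLinear.eq_sum_coeff {m : ℕ} (x : OrientedLinear m) :
    x = ∑ μ : Pairing m, coeff μ.diagram x • mk μ.diagram := by
  have key : LinearMap.id = ∑ μ : Pairing m, (coeff μ.diagram).smulRight (mk μ.diagram) := by
    refine hom_ext fun C => ?_
    rw [LinearMap.sum_apply, Finset.sum_eq_single ⟨C.partner, C.partner_partner, C.partner_ne⟩]
    · exact mk_eq_coeff_smul rfl
    · intro μ _ hμ
      rw [LinearMap.smulRight_apply, coeff_mk, if_neg, zero_smul]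
      intro h
      exact hμ (Subtype.ext h.symm)
    · intro h
      exact absurd (Finset.mem_univ _) h
  have := LinearMap.congr_fun key x
  simpa using this

/-! ### A diagram of long chords without symmetry, and what its amalgamations remember. -/

/-- The antipodal pairing of `0, …, 2l - 1`, modified so that `0, 1, 2` are paired with
`l + 1, l + 2, l`. -/
def longPartner (l v : ℕ) : ℕ :=
  if v = 0 then l + 1 else if v = 1 then l + 2 else if v = 2 then l else
  if v = l then 2 else if v = l + 1 then 0 else if v = l + 2 then 1 else
  if v < l then v + l else v - l

theorem longPartner_lt {l v : ℕ} (hl : 3 ≤ l) (hv : v < 2 * l) : longPartner l v < 2 * l := by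
  unfold longPartner
  split_ifs <;> omega

theorem longPartner_lt_iff {l v : ℕ} (hl : 3 ≤ l) (hv : v < 2 * l) :
    longPartner l v < l ↔ l ≤ v := by
  unfold longPartner
  split_ifs <;> omega

theorem longPartner_longPartner {l v : ℕ} (hl : 3 ≤ l) (hv : v < 2 * l) :
    longPartner l (longPartner l v) = v := by
  grind (splits := 20) [longPartner]

/-- The diagram with pairing `longPartner`: all chords are long, and it has no rotational
symmetry. -/
def longDiagram (l : ℕ) (hl : 3 ≤ l) : LinearDiagram l where
  partner v := ⟨longPartner l v.1, longPartner_lt hl v.2⟩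
  isTail v := decide (v.1 < l)
  partner_partner v := Fin.ext (longPartner_longPartner hl v.2)
  partner_ne v h := by
    have h1 := longPartner_lt_iff hl v.2
    have h2 : longPartner l v.1 = v.1 := congrArg Fin.val h
    omega
  isTail_partner v := by
    have h1 := longPartner_lt_iff hl v.2
    rw [← decide_not, decide_eq_decide]
    simp only
    omega

theorem longDiagram_partner_val {l : ℕ} (hl : 3 ≤ l) (v : Fin (2 * l)) :
    ((longDiagram l hl).partner v).1 =
      if v.1 = 0 then l + 1 else if v.1 = 1 then l + 2 else if v.1 = 2 then l else
      if v.1 = l then 2 else if v.1 = l + 1 then 0 else if v.1 = l + 2 then 1 else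
      if v.1 < l then v.1 + l else v.1 - l := rfl

theorem map_cyc_pow_partner_val {m s : ℕ} (hs : s ≤ 2 * m) (C : LinearDiagram m)
    (v : Fin (2 * m)) : ((C.map ((cyc m) ^ s)).partner v).1 =
      if s ≤ (C.partner (((cyc m) ^ s).symm v)).1 then (C.partner (((cyc m) ^ s).symm v)).1 - s
      else (C.partner (((cyc m) ^ s).symm v)).1 + 2 * m - s :=
  cyc_pow_val hs _

/-- Cyclic distances along chords lie between `l - 2` and `l + 2`. A rotation preserves them up to
exchanging `d` and `2 * l - d`, which respects this range. -/
theorem longDiagram_map_far {l t : ℕ} (hl : 3 ≤ l) (ht : t ≤ 2 * l) (w : Fin (2 * l)) :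
    (w.1 + l ≤ (((longDiagram l hl).map ((cyc l) ^ t)).partner w).1 + 2 ∧
        (((longDiagram l hl).map ((cyc l) ^ t)).partner w).1 ≤ w.1 + l + 2) ∨
      ((((longDiagram l hl).map ((cyc l) ^ t)).partner w).1 + l ≤ w.1 + 2 ∧
        w.1 ≤ (((longDiagram l hl).map ((cyc l) ^ t)).partner w).1 + l + 2) := by
  have h1 := map_cyc_pow_partner_val ht (longDiagram l hl) w
  have h2 := longDiagram_partner_val hl (((cyc l) ^ t).symm w)
  have h3 := cyc_symm_pow_val ht w
  have h4 := w.2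
  generalize (((longDiagram l hl).map ((cyc l) ^ t)).partner w).1 = a at *
  generalize ((longDiagram l hl).partner (((cyc l) ^ t).symm w)).1 = b at *
  generalize (((cyc l) ^ t).symm w).1 = c at *
  subst h1
  split_ifs at h2 h3 <;> split_ifs <;> omega

theorem eq_zero_of_longDiagram_map_eq {l t : ℕ} (hl : 5 ≤ l) (ht : t < 2 * l)
    (h : ((longDiagram l (by omega)).map ((cyc l) ^ t)).partner =
      (longDiagram l (by omega)).partner) : t = 0 := by
  -- Vertex `2` is the only one whose partner comes `l - 2` steps later in the cyclic order, so a
  -- symmetry has to fix it.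
  have h0 := congrArg Fin.val (congrFun h (((cyc l) ^ t) ⟨2, by omega⟩))
  have h1 := map_cyc_pow_partner_val ht.le (longDiagram l (by omega))
    (((cyc l) ^ t) ⟨2, by omega⟩)
  rw [Equiv.symm_apply_apply, longDiagram_partner_val] at h1
  have h2 := longDiagram_partner_val (show 3 ≤ l by omega) (((cyc l) ^ t) ⟨2, by omega⟩)
  have h3 := cyc_pow_val ht.le (⟨2, by omega⟩ : Fin (2 * l))
  rw [h1, h2] at h0
  simp only at h0 h3
  generalize (((cyc l) ^ t) ⟨2, by omega⟩).1 = c at *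
  clear h1 h2 h
  simp only [OfNat.ofNat_ne_zero, if_false, if_true, (by norm_num : ¬ (2 : ℕ) = 1)] at h0
  split_ifs at h0 h3 <;> omega

/-- In an amalgamation with a rotated `longDiagram`, the chords with an end outside the first
diagram are long. -/
theorem amalgam_longDiagram_far {m l k t : ℕ} (hm : 2 ≤ m) (hl : l = 3 * m + 2) (h : m + l = k + 1)
    (ht : t ≤ 2 * l) (C : LinearDiagram m) (j : Fin (2 * k)) (hj : 2 * m - 1 ≤ j.1) :
    let j' := ((amalgam (by omega) (by omega) h C
      ((longDiagram l (by omega)).map ((cyc l) ^ t))).partner j).1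
    (j.1 + (2 * m - 1) ≤ j' ∧ j' + (2 * m - 1) ≤ j.1 + 2 * k) ∨
      (j' + (2 * m - 1) ≤ j.1 ∧ j.1 + (2 * m - 1) ≤ j' + 2 * k) := by
  intro j'
  have hF := isFusion_amalgam (by omega) (by omega) h C
    ((longDiagram l (by omega)).map ((cyc l) ^ t))
  set D := (longDiagram l (by omega)).map ((cyc l) ^ t)
  have hj2 := j.2
  let w : Fin (2 * l) := ⟨j.1 - (2 * m - 2), by omega⟩
  have hw : w ≠ ⟨0, by omega⟩ := by
    intro h
    have := congrArg Fin.val h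
    simp only [w] at this
    omega
  have hjw : numberRight (by omega) h w = j := by
    ext
    simp only [numberRight, w]
    omega
  have far := longDiagram_map_far (show 3 ≤ l by omega) ht w
  change (w.1 + l ≤ (D.partner w).1 + 2 ∧ (D.partner w).1 ≤ w.1 + l + 2) ∨
    ((D.partner w).1 + l ≤ w.1 + 2 ∧ w.1 ≤ (D.partner w).1 + l + 2) at far
  by_cases hD : D.partner w = ⟨0, by omega⟩
  · have hw' : D.partner ⟨0, by omega⟩ = w := by rw [← hD, D.partner_partner]
    have e := congrArg Fin.val hF.partner_fused'
    rw [hw', hjw] at e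
    change j' = _ at e
    have := (C.partner ⟨0, by omega⟩).2
    rw [hD] at far
    simp only [numberLeft, w] at e far
    omega
  · have e := congrArg Fin.val (hF.partner_right w hw hD)
    rw [hjw] at e
    change j' = _ at e
    simp only [numberRight, w] at e far
    omega

/-- By `h1` and `h2`, both neighbours of vertex `0` in `C` keep their partners, which makes the
chords at the two ends of the block of `C` short. All chords leaving the block of `C'`, or outside
it, are long, so the blocks must coincide. -/
theorem eq_of_amalgam_longDiagram_eq {m l k s t : ℕ} (hm : 2 ≤ m) (hl : l = 3 * m + 2)
    (h : m + l = k + 1) (hs : s < 2 * k) (ht : t < 2 * l) {C C' : LinearDiagram m}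
    (h1 : (C.partner ⟨0, by omega⟩).1 ≠ 1) (h2 : (C.partner ⟨0, by omega⟩).1 ≠ 2 * m - 1)
    (e : ((amalgam (by omega) (by omega) h C'
      ((longDiagram l (by omega)).map ((cyc l) ^ t))).map ((cyc k) ^ s)).partner =
      (amalgam (by omega) (by omega) h C (longDiagram l (by omega))).partner) :
    s = 0 ∧ t = 0 ∧ C'.partner = C.partner := by
  have hF := isFusion_amalgam (by omega) (by omega) h C (longDiagram l (by omega))
  have hF' := isFusion_amalgam (by omega) (by omega) h C'
    ((longDiagram l (by omega)).map ((cyc l) ^ t))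
  set F := amalgam (by omega) (by omega) h C (longDiagram l (by omega))
  set F' := amalgam (by omega) (by omega) h C' ((longDiagram l (by omega)).map ((cyc l) ^ t))
  have far : ∀ j : Fin (2 * k), 2 * m - 1 ≤ j.1 →
      (j.1 + (2 * m - 1) ≤ (F'.partner j).1 ∧ (F'.partner j).1 + (2 * m - 1) ≤ j.1 + 2 * k) ∨
      ((F'.partner j).1 + (2 * m - 1) ≤ j.1 ∧ j.1 + (2 * m - 1) ≤ (F'.partner j).1 + 2 * k) :=
    amalgam_longDiagram_far hm hl h ht.le C'
  have near : ∀ i : ℕ, ∀ hi : i + 1 < 2 * m, i = 0 ∨ i = 2 * m - 2 →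
      (F.partner ⟨i, by omega⟩).1 < 2 * m - 1 ∧ (F.partner ⟨i, by omega⟩).1 ≠ i := by
    intro i hi hi'
    have a1 : (⟨i + 1, hi⟩ : Fin (2 * m)) ≠ ⟨0, by omega⟩ := by simp
    have a2 : C.partner ⟨i + 1, hi⟩ ≠ ⟨0, by omega⟩ := by
      intro hC
      have : C.partner ⟨0, by omega⟩ = ⟨i + 1, hi⟩ := by rw [← hC, C.partner_partner]
      rw [this] at h1 h2
      simp only at h1 h2
      omega
    have a3 := congrArg Fin.val (hF.partner_left _ a1 a2)
    have a4 := C.partner_ne ⟨i + 1, hi⟩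
    have a5 := (C.partner ⟨i + 1, hi⟩).2
    have a6 : (C.partner ⟨i + 1, hi⟩).1 ≠ i + 1 := fun hh => a4 (Fin.ext hh)
    have a7 : (C.partner ⟨i + 1, hi⟩).1 ≠ 0 := fun hh => a2 (Fin.ext hh)
    change (F.partner ⟨i, by omega⟩).1 = (C.partner ⟨i + 1, hi⟩).1 - 1 at a3
    omega
  have step : ∀ i : Fin (2 * k), (F.partner i).1 =
      if s ≤ (F'.partner (((cyc k) ^ s).symm i)).1 then (F'.partner (((cyc k) ^ s).symm i)).1 - s
      else (F'.partner (((cyc k) ^ s).symm i)).1 + 2 * k - s := by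
    intro i
    rw [← e]
    exact map_cyc_pow_partner_val hs.le F' i
  have s0 : s = 0 := by
    have b1 := near 0 (by omega) (Or.inl rfl)
    have b2 := near (2 * m - 2) (by omega) (Or.inr rfl)
    have c1 := step ⟨0, by omega⟩
    have c2 := step ⟨2 * m - 2, by omega⟩
    have d1 := cyc_symm_pow_val hs.le ⟨0, by omega⟩
    have d2 := cyc_symm_pow_val hs.le ⟨2 * m - 2, by omega⟩
    have f1 := far (((cyc k) ^ s).symm ⟨0, by omega⟩)
    have f2 := far (((cyc k) ^ s).symm ⟨2 * m - 2, by omega⟩)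
    have g1 := (F'.partner (((cyc k) ^ s).symm ⟨0, by omega⟩)).2
    have g2 := (F'.partner (((cyc k) ^ s).symm ⟨2 * m - 2, by omega⟩)).2
    simp only at d1 d2
    -- The ends `0` and `2 * m - 2` of the block come from the vertices `s` and `2 * m - 2 + s`
    -- (modulo `2 * k`) of `F'`, and both have to lie in the block of `F'`. The first gives `s < 2 *
    -- m - 1`, which rules out a wrap-around in the second and leaves `s = 0`.
    have hle : s < 2 * m - 1 := by
      by_contra hlt
      clear c2 d2 f2 b2
      split_ifs at c1 d1 <;> omega
    clear c1 d1 f1 b1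
    split_ifs at c2 d2 <;> omega
  subst s0
  have e' : F'.partner = F.partner := e
  obtain ⟨k1, k2⟩ := hF'.partner_eq hF e'
  exact ⟨rfl, eq_zero_of_longDiagram_map_eq (by omega) ht k2, k1⟩

/-- Among all the rotated amalgamations that make up the bracket, exactly one can contribute to this
coefficient, and it does so with the coefficient of `C`. -/
theorem coeff_amalgam_longDiagram {m l k s t : ℕ} (hm : 2 ≤ m) (hl : l = 3 * m + 2)
    (h : m + l = k + 1) (hs : s < 2 * k) (ht : t < 2 * l) {C : LinearDiagram m}
    (h1 : (C.partner ⟨0, by omega⟩).1 ≠ 1) (h2 : (C.partner ⟨0, by omega⟩).1 ≠ 2 * m - 1)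
    (x : OrientedLinear m) :
    coeff (amalgam (by omega) (by omega) h C (longDiagram l (by omega))) (((rotate k) ^ s)
      (amalgamLinear (by omega) (by omega) h x
        (((rotate l) ^ t) (mk (longDiagram l (by omega)))))) =
      if s = 0 ∧ t = 0 then coeff C x else 0 := by
  have key : (coeff (amalgam (by omega) (by omega) h C (longDiagram l (by omega)))).comp
      (((rotate k) ^ s).comp ((amalgamLinear (by omega) (by omega) h).flip
        (((rotate l) ^ t) (mk (longDiagram l (by omega)))))) =
      if s = 0 ∧ t = 0 then coeff C else 0 := by
    refine hom_ext fun C' => ?_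
    by_cases hst : (s = 0 ∧ t = 0) ∧ C'.partner = C.partner
    · obtain ⟨⟨rfl, rfl⟩, hC⟩ := hst
      rw [if_pos ⟨rfl, rfl⟩, mk_eq_coeff_smul hC, map_smul, map_smul, coeff_mk_self]
      congr 1
      change coeff _ (amalgamLinear _ _ h (mk C) (mk _)) = 1
      rw [amalgamLinear_mk, coeff_mk_self]
    · rw [LinearMap.comp_apply, LinearMap.comp_apply, LinearMap.flip_apply, rotate_pow_mk,
        amalgamLinear_mk, rotate_pow_mk, coeff_mk, if_neg]
      · split_ifs with h0
        · rw [coeff_mk, if_neg (fun hC => hst ⟨h0, hC⟩)]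
        · rfl
      · intro e
        have := eq_of_amalgam_longDiagram_eq hm hl h hs ht h1 h2 e
        tauto
  have := LinearMap.congr_fun key x
  split_ifs at this ⊢ with h0 <;> exact this

/-- An element of `𝓒_m` commuting with the class of `longDiagram` only involves diagrams in which
`0` is paired with a neighbour. -/
theorem coeff_eq_zero_of_homBracket_eq_zero {m l k : ℕ} (hm : 2 ≤ m) (hl : l = 3 * m + 2)
    (h : m + l = k + 1) {X : OrientedChord m}
    (hX : homBracket (by omega) (by omega) h X
      (cyclicSum l (mk (longDiagram l (by omega)))) = 0) {C : LinearDiagram m}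
    (h1 : (C.partner ⟨0, by omega⟩).1 ≠ 1) (h2 : (C.partner ⟨0, by omega⟩).1 ≠ 2 * m - 1) :
    coeff C X.1 = 0 := by
  rw [homBracket_apply] at hX
  have e := congrArg Subtype.val hX
  rw [cyclicSum_coe, cyclicSum_coe] at e
  replace e := congrArg
    (coeff (amalgam (by omega) (by omega) h C (longDiagram l (by omega)))) e
  simp only [map_sum, ZeroMemClass.coe_zero, map_zero] at e
  rw [Finset.sum_eq_single 0, Finset.sum_eq_single 0,
    coeff_amalgam_longDiagram hm hl h (by omega) (by omega) h1 h2, if_pos ⟨rfl, rfl⟩] at e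
  · exact e
  · intro t ht ht0
    rw [coeff_amalgam_longDiagram hm hl h (by omega) (Finset.mem_range.1 ht) h1 h2,
      if_neg (fun h => ht0 h.2)]
  · intro h0
    exact absurd (Finset.mem_range.2 (by omega)) h0
  · intro s hs hs0
    refine Finset.sum_eq_zero fun t ht => ?_
    rw [coeff_amalgam_longDiagram hm hl h (Finset.mem_range.1 hs) (Finset.mem_range.1 ht) h1 h2,
      if_neg (fun h => hs0 h.1)]
  · intro h0
    exact absurd (Finset.mem_range.2 (by omega)) h0

/-! ### Diagrams with only neighbouring chords, and the center. -/

/-- The partner of `0` is `1` or `2m - 1`. Going around the circle, each choice determines all other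
chords, since every next vertex has one neighbour already taken. -/
theorem LinearDiagram.partner_eq_of_adjacent {m : ℕ} (hm : 2 ≤ m) {C : LinearDiagram m}
    (hC : ∀ v, (C.partner v).1 = v.1 + 1 ∨ (C.partner v).1 + 1 = v.1 ∨
      (v.1 = 0 ∧ (C.partner v).1 = 2 * m - 1) ∨ (v.1 = 2 * m - 1 ∧ (C.partner v).1 = 0)) :
    C.partner = (isolatedLinear m).partner ∨
      C.partner = ((isolatedLinear m).map ((cyc m) ^ 1)).partner := by
  have inv : ∀ (i j : ℕ) (hi : i < 2 * m) (hj : j < 2 * m), (C.partner ⟨i, hi⟩).1 = j →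
      (C.partner ⟨j, hj⟩).1 = i := by
    rintro i j hi hj rfl
    rw [show (⟨(C.partner ⟨i, hi⟩).1, hj⟩ : Fin (2 * m)) = C.partner ⟨i, hi⟩ from rfl,
      C.partner_partner]
  by_cases h0 : (C.partner ⟨0, by omega⟩).1 = 1
  · left
    have even : ∀ i, ∀ hi : 2 * i < 2 * m, (C.partner ⟨2 * i, hi⟩).1 = 2 * i + 1 := by
      intro i
      induction i with
      | zero => intro _; exact h0
      | succ i ih =>
        intro hi
        have a1 := inv _ _ _ (by omega) (ih (by omega))
        have a2 := inv (2 * (i + 1)) (2 * i + 1) hi (by omega)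
        have a3 := hC ⟨2 * (i + 1), hi⟩
        simp only at a3
        omega
    funext v
    ext
    rw [isolatedLinear_partner_val]
    split_ifs with hv
    · have := even (v.1 / 2) (by omega)
      rw [show (⟨2 * (v.1 / 2), by omega⟩ : Fin (2 * m)) = v from Fin.ext (by simp only; omega)]
        at this
      omega
    · have := inv _ _ _ (by omega) (even (v.1 / 2) (by omega))
      rw [show (⟨2 * (v.1 / 2) + 1, by omega⟩ : Fin (2 * m)) = v from
        Fin.ext (by simp only; omega)] at this
      omega
  · right
    have h0' : (C.partner ⟨0, by omega⟩).1 = 2 * m - 1 := by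
      have := hC ⟨0, by omega⟩
      simp only at this
      omega
    have odd : ∀ i, ∀ hi : 2 * i + 2 < 2 * m, (C.partner ⟨2 * i + 1, by omega⟩).1 = 2 * i + 2 := by
      intro i
      induction i with
      | zero =>
        intro _
        have a2 := inv 1 0 (by omega) (by omega)
        have a3 := hC ⟨1, by omega⟩
        simp only at a3
        simp only [mul_zero, zero_add]
        omega
      | succ i ih =>
        intro hi
        have a1 := inv _ _ _ (by omega) (ih (by omega))
        have a2 := inv (2 * (i + 1) + 1) (2 * i + 2) (by omega) (by omega)
        have a3 := hC ⟨2 * (i + 1) + 1, by omega⟩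
        simp only at a3
        omega
    funext v
    ext
    have hv2 := v.2
    rw [map_cyc_pow_partner_val (by omega), isolatedLinear_partner_val,
      cyc_symm_pow_val (by omega)]
    by_cases hv0 : v.1 = 0
    · rw [show v = ⟨0, by omega⟩ from Fin.ext hv0, h0']
      simp only
      split_ifs <;> first | contradiction | omega
    by_cases hv1 : v.1 = 2 * m - 1
    · rw [show v = ⟨2 * m - 1, by omega⟩ from Fin.ext hv1, inv _ _ _ (by omega) h0']
      simp only
      split_ifs <;> first | contradiction | omega
    by_cases hv : v.1 % 2 = 1
    · have := odd (v.1 / 2) (by omega)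
      rw [show (⟨2 * (v.1 / 2) + 1, by omega⟩ : Fin (2 * m)) = v from
        Fin.ext (by simp only; omega)] at this
      split_ifs <;> omega
    · have := inv _ _ _ (by omega) (odd (v.1 / 2 - 1) (by omega))
      rw [show (⟨2 * (v.1 / 2 - 1) + 2, by omega⟩ : Fin (2 * m)) = v from
        Fin.ext (by simp only; omega)] at this
      split_ifs <;> omega

theorem mem_span_Omega_of_homBracket_eq_zero {m l k : ℕ} (hm : 2 ≤ m) (hl : l = 3 * m + 2)
    (h : m + l = k + 1) {X : OrientedChord m}
    (hX : homBracket (by omega) (by omega) h X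
      (cyclicSum l (mk (longDiagram l (by omega)))) = 0) : X ∈ Submodule.span ℚ {Omega m} := by
  -- By invariance `N(X) = 2m X`, so it suffices to apply `N` to each diagram occurring in `X`; it
  -- does not distinguish `I_m` from its rotation.
  have h1 : cyclicSum m X.1 ∈ Submodule.span ℚ {Omega m} := by
    rw [eq_sum_coeff X.1, map_sum]
    refine Submodule.sum_mem _ fun μ _ => ?_
    by_cases h0 : coeff μ.diagram X.1 = 0
    · rw [h0, zero_smul, map_zero]
      exact Submodule.zero_mem _
    rw [map_smul]
    refine Submodule.smul_mem _ _ ?_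
    rcases LinearDiagram.partner_eq_of_adjacent hm (C := μ.diagram) (by
      intro v
      by_contra hv
      apply h0
      -- Rotating by `v` brings the offending vertex `v` to position `0` without changing the
      -- invariant `X`.
      rw [← coeff_map_rotate v.1, rotate_pow_coe]
      have hv2 := v.2
      have hv3 := (μ.diagram.partner v).2
      have e0 : ((cyc m) ^ v.1).symm ⟨0, by omega⟩ = v := by
        ext
        rw [cyc_symm_pow_val (by omega)]
        simp only
        split_ifs <;> omega
      have e1 := map_cyc_pow_partner_val (show v.1 ≤ 2 * m by omega) μ.diagram ⟨0, by omega⟩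
      rw [e0] at e1
      refine coeff_eq_zero_of_homBracket_eq_zero hm hl h hX ?_ ?_ <;> rw [e1] <;>
        split_ifs <;> omega) with hμ | hμ
    · rw [mk_eq_coeff_smul hμ, map_smul]
      exact Submodule.smul_mem _ _ (Submodule.mem_span_singleton_self _)
    · rw [mk_eq_coeff_smul hμ, map_smul, mk_map_cyc_pow, cyclicSum_rotate_pow]
      exact Submodule.smul_mem _ _ (Submodule.mem_span_singleton_self _)
  have h2 : cyclicSum m X.1 = ((2 * m : ℕ) : ℚ) • X := by
    ext1
    rw [cyclicSum_coe]
    simp only [rotate_pow_coe]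
    rw [Finset.sum_const, Finset.card_range, ← Nat.cast_smul_eq_nsmul ℚ]
    rfl
  have h3 : ((2 * m : ℕ) : ℚ) ≠ 0 := Nat.cast_ne_zero.2 (by omega)
  rw [h2] at h1
  exact (Submodule.smul_mem_iff _ h3).1 h1

theorem homBracket_eq_zero_of_mem_span_Omega {m l k : ℕ} (hm : 0 < m) (hl : 0 < l)
    (h : m + l = k + 1) {X : OrientedChord m} (hX : X ∈ Submodule.span ℚ {Omega m})
    (Y : OrientedChord l) : homBracket hm hl h X Y = 0 := by
  obtain ⟨c, rfl⟩ := Submodule.mem_span_singleton.1 hX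
  rw [map_smul, LinearMap.smul_apply, homBracket_Omega, smul_zero]

/-- The component of `X` in degree `m` is isolated by bracketing `X` with an element concentrated in
degree `3m + 2` and looking at degree `4m + 1`. -/
theorem chordCenter_eq : chordCenter = Submodule.pi Set.univ
    (fun i : {m : ℕ // 2 ≤ m} => Submodule.span ℚ {Omega i.1}) := by
  ext X
  rw [Submodule.mem_pi]
  constructor
  · rintro hX ⟨m, hm⟩ -
    refine mem_span_Omega_of_homBracket_eq_zero (l := 3 * m + 2) (k := 4 * m + 1) hm rfl
      (by omega) ?_
    rw [← chordBracket_single_right X hm (Nat.le_add_left 2 (3 * m))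
      (show 2 ≤ 4 * m + 1 by omega), hX]
    rfl
  · intro hX Y
    funext k
    rw [chordBracket_apply]
    refine Finset.sum_eq_zero fun p _ => ?_
    split_ifs with h
    · exact homBracket_eq_zero_of_mem_span_Omega _ _ _ (hX ⟨p.1.1, h.1⟩ (Set.mem_univ _)) _
    · rfl

theorem single_mem_chordCenter {m : ℕ} (hm : 2 ≤ m) (X : OrientedChord m)
    (hX : ∀ Y : OrientedChord (3 * m + 2), chordBracket (Pi.single ⟨m, hm⟩ X)
      (Pi.single ⟨3 * m + 2, Nat.le_add_left 2 (3 * m)⟩ Y) = 0) :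
    (Pi.single ⟨m, hm⟩ X : ChordAlgebra) ∈ chordCenter := by
  rw [chordCenter_eq, Submodule.mem_pi]
  intro i _
  by_cases hi : i = ⟨m, hm⟩
  · subst hi
    rw [Pi.single_eq_same]
    refine mem_span_Omega_of_homBracket_eq_zero (l := 3 * m + 2) (k := 4 * m + 1) hm rfl
      (by omega) ?_
    have h := chordBracket_single_right (Pi.single ⟨m, hm⟩ X) hm
      (Nat.le_add_left 2 (3 * m)) (show 2 ≤ 4 * m + 1 by omega) (by omega)
      (cyclicSum (3 * m + 2) (mk (longDiagram (3 * m + 2) (by omega))))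
    rw [hX, Pi.single_eq_same] at h
    exact h.symm
  · rw [Pi.single_eq_of_ne hi]
    exact Submodule.zero_mem _

theorem theorem3p2 :
    -- the bilinear bracket makes `𝓒` a Lie algebra over `ℚ`
    ((∀ X : ChordAlgebra, chordBracket X X = 0) ∧
      (∀ X Y Z : ChordAlgebra,
        chordBracket X (chordBracket Y Z) =
          chordBracket (chordBracket X Y) Z + chordBracket Y (chordBracket X Z))) ∧
    -- its center is `∏_{m ≥ 2} ℚ Ω_m`
    chordCenter = Submodule.pi Set.univ
      (fun i : {m : ℕ // 2 ≤ m} => Submodule.span ℚ {Omega i.1}) ∧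
    -- `X ∈ 𝓒_m` is central as soon as it commutes with `𝓒_{3m + 2}`
    (∀ (m : ℕ) (hm : 2 ≤ m) (X : OrientedChord m),
      (∀ Y : OrientedChord (3 * m + 2),
        chordBracket (Pi.single ⟨m, hm⟩ X) (Pi.single ⟨3 * m + 2, by omega⟩ Y) = 0) →
      (Pi.single ⟨m, hm⟩ X : ChordAlgebra) ∈ chordCenter) := by
  exact ⟨⟨chordBracket_self, chordBracket_jacobi⟩, chordCenter_eq,
    fun _ hm X hX => single_mem_chordCenter hm X hX⟩
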